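/- For integers $m\ge d\ge 1$ put $$B_d(m)=2\bigl(c(m,m-d+1)+c(m,m-d+3)+c(m,m-d+5)+\cdots\bigr),$$ where $c(m,k)$ is the number of permutations of $m$ elements with exactly $k$ cycles (the signless Stirling number of the first kind; the sum is finite since $c(m,k)=0$ for $k>m$). Let $P$ be a convex polytope in $\mathbb{R}^d$, $d\ge 1$, and let $p$ be a point in the interior of $P$. Let $L$ be a directed line through $p$ that meets the affine span of every facet of $P$ in exactly one point, these points being distinct for distinct facets. The line shelling of $P$ with shelling line $L$ is the ordering $(F_1,\dots,F_m)$ of all the facets of $P$ in which their affine spans are met when one travels along $L$ from $p$ in the direction of $L$ out to infinity and then returns from infinity on the opposite side to $p$. Let $\mathrm{ls}(P,p)$ be the number of distinct orderings of the facets of $P$ that arise in this way from directed lines $L$ through $p$. If $P$ has $m$ facets, then $$\mathrm{ls}(P,p)\le B_d(m).$$ This inequality is best possible: for every $d\ge 2$ and every $m\ge d+1$, and also for $d=1$ and $m=2$, there are a convex polytope $P$ in $\mathbb{R}^d$ with $m$ facets and a point $p$ in the interior of $P$ such that $\mathrm{ls}(P,p)=B_d(m)$. -/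

import Mathlib

/-- A convex polytope: the convex hull of finitely many points. -/
def IsConvexPolytope {E : Type*} [AddCommGroup E] [Module ℝ E] (P : Set E) : Prop :=
  ∃ S : Finset E, P = convexHull ℝ (S : Set E)

/-- The set of facets of a polytope `P`: the nonempty faces `F` of `P` (a face is the set of
points of `P` at which some linear functional attains its maximum over `P`) whose dimension is
`dim P - 1`. -/
def polytopeFacets {E : Type*} [NormedAddCommGroup E] [NormedSpace ℝ E] (P : Set E) :
    Set (Set E) :=
  {F | F.Nonempty ∧ IsExposed ℝ P F ∧
    Module.finrank ℝ (affineSpan ℝ F).direction + 1 =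
      Module.finrank ℝ (affineSpan ℝ P).direction}

/-- The order in which the points with (nonzero) parameters `s`, `t` are met on a directed line
by a traveller who starts at parameter `0`, moves in the positive direction out to infinity and
comes back from infinity on the opposite side: first the positive parameters in increasing order,
then the negative ones in increasing order. `TravelsBefore s t` says that `s` is met strictly
before `t`. -/
def TravelsBefore (s t : ℝ) : Prop :=
  (0 < s ∧ s < t) ∨ (0 < s ∧ t < 0) ∨ (s < t ∧ t < 0)

/-- `IsLineShelling P p F`: the sequence `F 0, F 1, …, F (m - 1)` is the line shelling of `P`
induced by some directed line `{p + t u}` through `p`. That is, the sequence lists all facets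
of `P`, the line meets the affine span of each facet `F i` in exactly one point, with parameter
`t i`, these points are pairwise distinct, and the facets are listed in the order in which a
traveller starting at `p` in direction `u`, and passing through infinity, meets their affine
spans. (Distinctness of the points, hence of the facets, follows from the strict order.) -/
def IsLineShelling {E : Type*} [NormedAddCommGroup E] [NormedSpace ℝ E] (P : Set E) (p : E)
    {m : ℕ} (F : Fin m → Set E) : Prop :=
  Set.range F = polytopeFacets P ∧
    ∃ (u : E) (t : Fin m → ℝ), u ≠ 0 ∧
      (∀ i, ∀ s : ℝ, p + s • u ∈ affineSpan ℝ (F i) ↔ s = t i) ∧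
      ∀ i j, i < j → TravelsBefore (t i) (t j)

/-- The set of line shellings, as orderings of the `m` facets of `P`, whose shelling line passes
through `p`. -/
def lineShellings {E : Type*} [NormedAddCommGroup E] [NormedSpace ℝ E] (P : Set E) (p : E)
    (m : ℕ) : Set (Fin m → Set E) :=
  {F | IsLineShelling P p F}

/-- `2 (c(m, m-d+1) + c(m, m-d+3) + c(m, m-d+5) + ⋯)` for `d ≤ m`, where `c(m, k)` is the signless
Stirling number of the first kind. The terms with `2 j ≥ d`, which are left out, vanish, since
`c(m, k) = 0` for `k > m`. -/
def lineShellingBound (d m : ℕ) : ℕ :=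
  2 * ∑ j ∈ Finset.range d, Nat.stirlingFirst m (m - d + 1 + 2 * j)

/-!
Place the interior point `p` at the origin. The affine span of a facet is then a hyperplane
`a i x = 1`, and the line with direction `u` meets it at the parameter `(a i u)⁻¹`. Travelling along
the line through infinity lists these parameters by decreasing value of `a i u`. Hence the line
shellings through `p` correspond to the orderings that the values of the functionals `a i` assume
at points `u` (`sweepOrders`, `encard_lineShellings`). That no `a i u` may vanish costs nothing, as
`u` can be perturbed.

The orderings are counted by inserting one functional `f 0` into a family `f 1, …, f n` on a space
of dimension `d`. Over an ordering of the old family, the new index moves through consecutive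
positions, because the points inducing that ordering form a convex set. Every possible step past
`f i` corresponds to an ordering of the old family on the hyperplane `f 0 = f i`, of dimension
`d - 1`. So the maximal number of orderings satisfies `N (d, n + 1) ≤ N (d, n) + n * N (d - 1, n)`
(`ncard_sweepOrders_succ_le`), with equality if `f 0` differs from every `f i`
(`ncard_sweepOrders_succ_eq`). The same recursion follows from that of the Stirling numbers for the
bound of the theorem (`genericSweepCount_eq_lineShellingBound`).

For equality throughout, the hyperplanes met in the recursion must always drop the dimension. This
holds for a family in general position (`SweepGeneric`), a property that is inherited by the
restrictions to these hyperplanes (`SweepGeneric.domRestrict`). To realize such a family by a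
polytope, one takes distinct unit vectors surrounding the origin and moves them slightly into
general position; the polyhedron `{x | ∀ i, ⟪a i, x⟫ ≤ 1}` is then a polytope with one facet for each
`a i` (`IsPolarConfiguration.encard_lineShellings`).
-/

/-! ### Orderings induced by functionals, and insertion of a functional -/

/-- The orderings of the index set that a family `f` of linear functionals induces at the points
where its values are pairwise distinct. An ordering is encoded as the relation "has the smaller
value". -/
def sweepOrders {V : Type*} [AddCommGroup V] [Module ℝ V] {n : ℕ} (f : Fin n → V →ₗ[ℝ] ℝ) :
    Set (Fin n → Fin n → Prop) :=
  {r | ∃ u : V, Function.Injective (fun i => f i u) ∧ r = fun i j => f i u < f j u}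

/-- The orderings of the indices of all but the functional `f 0` that occur at points where `f 0`
takes the same value as `f i.succ`. -/
def sweepOrdersOn {V : Type*} [AddCommGroup V] [Module ℝ V] {n : ℕ} (f : Fin (n + 1) → V →ₗ[ℝ] ℝ)
    (i : Fin n) : Set (Fin n → Fin n → Prop) :=
  sweepOrders fun j => (f j.succ).domRestrict (LinearMap.ker (f 0 - f i.succ))

/-- The relation induced on the indices other than `0`. -/
def tailRel {n : ℕ} (r : Fin (n + 1) → Fin (n + 1) → Prop) : Fin n → Fin n → Prop :=
  fun i j => r i.succ j.succ

/-- The orderings in `sweepOrders f` in which `i.succ` is the immediate successor of `0` and in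
which `0` and `i.succ` can be made to coincide without changing the order of the other indices. -/
def crossableOrders {V : Type*} [AddCommGroup V] [Module ℝ V] {n : ℕ}
    (f : Fin (n + 1) → V →ₗ[ℝ] ℝ) (i : Fin n) : Set (Fin (n + 1) → Fin (n + 1) → Prop) :=
  {r | r ∈ sweepOrders f ∧ r 0 i.succ ∧ (∀ j, r 0 j.succ → j = i ∨ r i.succ j.succ) ∧
    tailRel r ∈ sweepOrdersOn f i}

section Sweep

variable {V : Type*} [AddCommGroup V] [Module ℝ V] {n : ℕ}

theorem mem_sweepOrdersOn {f : Fin (n + 1) → V →ₗ[ℝ] ℝ} {i : Fin n} {r : Fin n → Fin n → Prop} :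
    r ∈ sweepOrdersOn f i ↔ ∃ u : V, f 0 u = f i.succ u ∧
      Function.Injective (fun j : Fin n => f j.succ u) ∧ r = fun j k => f j.succ u < f k.succ u := by
  constructor
  · rintro ⟨⟨u, hu⟩, h1, h2⟩
    exact ⟨u, sub_eq_zero.1 (by simpa using hu), h1, h2⟩
  · rintro ⟨u, hu, h1, h2⟩
    exact ⟨⟨u, by simp [hu]⟩, h1, h2⟩

/-- An ordering is determined by the order of the indices other than `0` and the set of indices
below `0`. -/
theorem sweepOrders_ext {f : Fin (n + 1) → V →ₗ[ℝ] ℝ} {r s : Fin (n + 1) → Fin (n + 1) → Prop}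
    (hr : r ∈ sweepOrders f) (hs : s ∈ sweepOrders f) (htail : tailRel r = tailRel s)
    (h0 : ∀ j : Fin n, r j.succ 0 ↔ s j.succ 0) : r = s := by
  obtain ⟨u, hu, rfl⟩ := hr
  obtain ⟨w, hw, rfl⟩ := hs
  funext i j
  have key : ∀ (x : V), Function.Injective (fun i => f i x) → ∀ k : Fin n,
      f 0 x < f k.succ x ↔ ¬ f k.succ x < f 0 x := by
    intro x hx k
    rw [not_lt]
    refine ⟨le_of_lt, fun h => lt_of_le_of_ne h fun h' => ?_⟩
    exact (Fin.succ_ne_zero k) (hx h').symm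
  refine Fin.cases ?_ (fun i => ?_) i <;> refine Fin.cases ?_ (fun j => ?_) j
  · simp
  · rw [key u hu, key w hw]; exact congrArg Not (propext (h0 j))
  · exact propext (h0 i)
  · exact congrFun (congrFun htail i) j

theorem tailRel_mem_sweepOrders {f : Fin (n + 1) → V →ₗ[ℝ] ℝ}
    {r : Fin (n + 1) → Fin (n + 1) → Prop} (hr : r ∈ sweepOrders f) :
    tailRel r ∈ sweepOrders (fun j : Fin n => f j.succ) := by
  obtain ⟨u, hu, rfl⟩ := hr
  exact ⟨u, fun i j h => Fin.succ_injective _ (hu h), rfl⟩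

theorem injOn_tailRel_crossableOrders (f : Fin (n + 1) → V →ₗ[ℝ] ℝ) (i : Fin n) :
    Set.InjOn tailRel (crossableOrders f i) := by
  -- the indices below `0` are exactly those below its immediate successor `i.succ`
  have key : ∀ r ∈ crossableOrders f i, ∀ j : Fin n, r j.succ 0 ↔ tailRel r j i := by
    rintro r ⟨⟨u, hu, rfl⟩, h1, h2, -⟩ j
    refine ⟨fun h => lt_trans h h1, fun h => ?_⟩
    by_contra h'
    have hne : f 0 u ≠ f j.succ u := fun h => (Fin.succ_ne_zero j) (hu h).symm
    rcases h2 j (lt_of_le_of_ne (not_lt.1 h') hne) with rfl | h3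
    · exact lt_irrefl _ h
    · exact lt_asymm h h3
  intro r hr s hs h
  exact sweepOrders_ext hr.1 hs.1 h fun j => by rw [key r hr, key s hs, h]

theorem disjoint_crossableOrders (f : Fin (n + 1) → V →ₗ[ℝ] ℝ) {i j : Fin n} (hij : i ≠ j) :
    Disjoint (crossableOrders f i) (crossableOrders f j) := by
  rw [Set.disjoint_left]
  rintro r ⟨⟨u, hu, rfl⟩, h1, h2, -⟩ ⟨-, h3, h4, -⟩
  rcases h2 j h3 with h | h
  · exact hij h.symm
  · rcases h4 i h1 with h' | h'
    · exact hij h'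
    · exact lt_asymm h h'

/-- If two points induce the same order on the indices other than `0`, and some index changes side
relative to `0` between them, then by convexity the index directly above `0` at the first point
meets `0` somewhere on the segment between the two. -/
theorem exists_mem_crossableOrders {f : Fin (n + 1) → V →ₗ[ℝ] ℝ} {u w : V}
    (hu : Function.Injective (fun i => f i u))
    (h : tailRel (fun i j => f i u < f j u) = tailRel (fun i j => f i w < f j w))
    {j : Fin n} (hju : f 0 u < f j.succ u) (hjw : f j.succ w < f 0 w) :
    ∃ i, (fun i j => f i u < f j u) ∈ crossableOrders f i := by
  classical
  have h' : ∀ k l : Fin n, f k.succ u < f l.succ u ↔ f k.succ w < f l.succ w := fun k l =>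
    iff_of_eq (congrFun (congrFun h k) l)
  obtain ⟨i, hi, hmin⟩ := Finset.exists_min_image
    (Finset.univ.filter fun k : Fin n => f 0 u < f k.succ u) (fun k => f k.succ u) ⟨j, by simpa⟩
  simp only [Finset.mem_filter, Finset.mem_univ, true_and] at hi hmin
  have hiw : f i.succ w < f 0 w :=
    lt_of_le_of_lt (not_lt.1 fun h1 => not_lt.2 (hmin j hju) ((h' _ _).2 h1)) hjw
  refine ⟨i, ⟨u, hu, rfl⟩, hi, fun k hk => ?_, mem_sweepOrdersOn.2 ?_⟩
  · by_cases hki : k = i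
    · exact Or.inl hki
    · refine Or.inr (lt_of_le_of_ne (hmin k hk) fun h => hki ?_)
      exact Fin.succ_injective _ (hu h).symm
  · -- the point of the segment from `u` to `w` at which `f 0` and `f i.succ` agree
    set α := f i.succ u - f 0 u with hα
    set β := f 0 w - f i.succ w with hβ
    have hα0 : 0 < α := sub_pos.2 hi
    have hβ0 : 0 < β := sub_pos.2 hiw
    have hlt : ∀ k l : Fin n, f k.succ u < f l.succ u →
        f k.succ (β • u + α • w) < f l.succ (β • u + α • w) := fun k l hkl => by
      have h1 := mul_lt_mul_of_pos_left hkl hβ0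
      have h2 := mul_lt_mul_of_pos_left ((h' _ _).1 hkl) hα0
      simp only [map_add, map_smul, smul_eq_mul]
      linarith
    have hinj : Function.Injective (fun j : Fin n => f j.succ (β • u + α • w)) := by
      intro k l hkl
      by_contra hne
      have : f k.succ u ≠ f l.succ u := fun h => hne (Fin.succ_injective _ (hu h))
      rcases lt_or_gt_of_ne this with h1 | h1
      · exact (hlt _ _ h1).ne hkl
      · exact (hlt _ _ h1).ne' hkl
    refine ⟨β • u + α • w, ?_, hinj, ?_⟩
    · simp only [map_add, map_smul, smul_eq_mul, hα, hβ]; ring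
    · funext k l
      refine propext ⟨hlt k l, fun hkl => ?_⟩
      by_contra hnot
      rcases (not_lt.1 hnot).lt_or_eq with h1 | h1
      · exact lt_asymm hkl (hlt _ _ h1)
      · have := Fin.succ_injective _ (hu h1)
        subst this
        exact lt_irrefl _ hkl

theorem injOn_tailRel_not_crossable (f : Fin (n + 1) → V →ₗ[ℝ] ℝ) :
    Set.InjOn tailRel (sweepOrders f \ ⋃ i, crossableOrders f i) := by
  rintro r ⟨hr, hr'⟩ s ⟨hs, hs'⟩ h
  simp only [Set.mem_iUnion] at hr' hs'
  refine sweepOrders_ext hr hs h fun j => ?_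
  obtain ⟨u, hu, rfl⟩ := hr
  obtain ⟨w, hw, rfl⟩ := hs
  have hne : ∀ x, Function.Injective (fun i => f i x) → f 0 x ≠ f j.succ x :=
    fun x hx h => (Fin.succ_ne_zero j) (hx h).symm
  constructor
  · intro h1
    by_contra h2
    exact hs' (exists_mem_crossableOrders hw h.symm
      (lt_of_le_of_ne (not_lt.1 h2) (hne w hw)) h1)
  · intro h1
    by_contra h2
    exact hr' (exists_mem_crossableOrders hu h
      (lt_of_le_of_ne (not_lt.1 h2) (hne u hu)) h1)

theorem ncard_sweepOrders_eq_add (f : Fin (n + 1) → V →ₗ[ℝ] ℝ) :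
    (sweepOrders f).ncard = (sweepOrders f \ ⋃ i, crossableOrders f i).ncard +
      ∑ i, (crossableOrders f i).ncard := by
  have hsub : (⋃ i, crossableOrders f i) ⊆ sweepOrders f :=
    Set.iUnion_subset fun i r hr => hr.1
  rw [← Set.ncard_sdiff_add_ncard_of_subset hsub (Set.toFinite _)]
  congr 1
  rw [← finsum_eq_sum_of_fintype]
  exact Set.ncard_iUnion_of_finite (fun i => Set.toFinite _) fun i j hij =>
    disjoint_crossableOrders f hij

/-- Inserting a functional: each ordering of the larger family either is the unique uncrossable
extension of an ordering of the smaller one, or is determined by the successor of the new index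
and an ordering on the hyperplane where the two agree. -/
theorem ncard_sweepOrders_succ_le (f : Fin (n + 1) → V →ₗ[ℝ] ℝ) :
    (sweepOrders f).ncard ≤ (sweepOrders fun j : Fin n => f j.succ).ncard +
      ∑ i, (sweepOrdersOn f i).ncard := by
  rw [ncard_sweepOrders_eq_add]
  refine add_le_add ?_ (Finset.sum_le_sum fun i _ => ?_)
  · exact Set.ncard_le_ncard_of_injOn tailRel (fun r hr => tailRel_mem_sweepOrders hr.1)
      (injOn_tailRel_not_crossable f) (Set.toFinite _)
  · exact Set.ncard_le_ncard_of_injOn tailRel (fun r hr => hr.2.2.2)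
      (injOn_tailRel_crossableOrders f i) (Set.toFinite _)

/-- A small displacement of `u` keeps all strict inequalities between the values at `u`. -/
theorem exists_pos_forall_lt {ι : Type*} [Finite ι] (f : ι → V →ₗ[ℝ] ℝ) (u v : V) :
    ∃ ε : ℝ, 0 < ε ∧ ∀ i j, f i u < f j u → f i (u + ε • v) < f j (u + ε • v) := by
  have h : ∀ᶠ ε : ℝ in nhds 0, ∀ i j, f i u < f j u → f i (u + ε • v) < f j (u + ε • v) := by
    simp only [Filter.eventually_all]
    intro i j hij
    have hc : ∀ k, Continuous fun ε : ℝ => f k (u + ε • v) := fun k => by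
      simp only [map_add, map_smul, smul_eq_mul]; fun_prop
    exact (hc i).continuousAt.eventually_lt (hc j).continuousAt (by simpa using hij)
  obtain ⟨δ, hδ, h⟩ := Metric.eventually_nhds_iff.1 h
  exact ⟨δ / 2, by positivity, h (by simp [abs_of_pos hδ, hδ])⟩

theorem injective_of_forall_lt {ι : Type*} {g h : ι → ℝ} (hg : Function.Injective g)
    (hgh : ∀ i j, g i < g j → h i < h j) : Function.Injective h := by
  intro i j hij
  by_contra hne
  rcases lt_or_gt_of_ne (fun h => hne (hg h) : g i ≠ g j) with h1 | h1
  · exact (hgh _ _ h1).ne hij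
  · exact (hgh _ _ h1).ne' hij

theorem lt_iff_of_forall_lt {ι : Type*} {g h : ι → ℝ} (hg : Function.Injective g)
    (hgh : ∀ i j, g i < g j → h i < h j) (i j : ι) : g i < g j ↔ h i < h j := by
  refine ⟨hgh i j, fun h1 => ?_⟩
  by_contra h2
  rcases (not_lt.1 h2).lt_or_eq with h3 | h3
  · exact lt_asymm h1 (hgh _ _ h3)
  · rw [hg h3] at h1
    exact lt_irrefl _ h1

/-- An ordering on the hyperplane `f 0 = f i.succ` extends to one with `i.succ` directly above `0`
and to one in which the indices below `0` are `i.succ` and the ones below it. -/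
theorem exists_extensions_of_mem_sweepOrdersOn {f : Fin (n + 1) → V →ₗ[ℝ] ℝ} {i : Fin n}
    (hi : f 0 ≠ f i.succ) {r : Fin n → Fin n → Prop} (hr : r ∈ sweepOrdersOn f i) :
    (∃ s ∈ crossableOrders f i, tailRel s = r) ∧
      ∃ s ∈ sweepOrders f, tailRel s = r ∧ ∀ j : Fin n, s j.succ 0 ↔ j = i ∨ r j i := by
  have hr0 := hr
  obtain ⟨u, hu0, hu, rfl⟩ := mem_sweepOrdersOn.1 hr
  -- a direction in which `f i.succ` overtakes `f 0`
  obtain ⟨v, hv⟩ : ∃ v, f 0 v < f i.succ v := by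
    obtain ⟨v, hv⟩ := not_forall.1 fun h => hi (LinearMap.ext h)
    rcases lt_or_gt_of_ne hv with h | h
    · exact ⟨v, h⟩
    · exact ⟨-v, by simpa using h⟩
  have key : ∀ x : V, f 0 x ≠ f i.succ x → ∃ y : V, Function.Injective (fun k => f k y) ∧
      (∀ k l, f k u < f l u → f k y < f l y) ∧
      (f 0 y < f i.succ y ↔ f 0 x < f i.succ x) := by
    intro x hx
    obtain ⟨ε, hε, hlt⟩ := exists_pos_forall_lt f u x
    have h0i : (f 0 (u + ε • x) < f i.succ (u + ε • x) ↔ f 0 x < f i.succ x) := by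
      simp only [map_add, map_smul, smul_eq_mul, hu0, add_lt_add_iff_left]
      exact mul_lt_mul_iff_right₀ hε
    have h0i' : f 0 (u + ε • x) ≠ f i.succ (u + ε • x) := by
      simp only [map_add, map_smul, smul_eq_mul, hu0]
      intro h
      exact hx (mul_left_cancel₀ hε.ne' (add_left_cancel h))
    have hne : ∀ k l, f k u ≠ f l u → f k (u + ε • x) ≠ f l (u + ε • x) := fun k l h => by
      rcases lt_or_gt_of_ne h with h | h
      · exact (hlt _ _ h).ne
      · exact (hlt _ _ h).ne'
    have hj : ∀ j : Fin n, f 0 (u + ε • x) ≠ f j.succ (u + ε • x) := fun j => by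
      by_cases hji : j = i
      · subst hji; exact h0i'
      · exact hne _ _ fun h => hji (hu (h.symm.trans hu0))
    refine ⟨u + ε • x, ?_, hlt, h0i⟩
    intro k l
    refine Fin.cases ?_ (fun k => ?_) k <;> refine Fin.cases ?_ (fun l => ?_) l
    · intro _; rfl
    · intro h; exact absurd h (hj l)
    · intro h; exact absurd h.symm (hj k)
    · intro h
      by_contra hkl
      exact hne k.succ l.succ (fun h => hkl (congrArg Fin.succ (hu h))) h
  have htail : ∀ y : V, (∀ k l, f k u < f l u → f k y < f l y) →
      tailRel (fun k l => f k y < f l y) = fun k l => f k.succ u < f l.succ u := fun y hy => by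
    funext k l
    exact propext (lt_iff_of_forall_lt hu (fun k l => hy k.succ l.succ) k l).symm
  constructor
  · obtain ⟨y, hy1, hy2, hy3⟩ := key v hv.ne
    refine ⟨_, ⟨⟨y, hy1, rfl⟩, hy3.2 hv, fun j hj => ?_, ?_⟩, htail y hy2⟩
    · by_contra h
      push Not at h
      rcases lt_or_gt_of_ne (fun h' => h.1 (hu h') : f j.succ u ≠ f i.succ u) with h1 | h1
      · exact lt_asymm hj (hy2 _ _ (h1.trans_eq hu0.symm))
      · exact absurd (hy2 _ _ h1) (not_lt.2 h.2)
    · rw [htail y hy2]; exact hr0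
  · obtain ⟨y, hy1, hy2, hy3⟩ := key (-v) (by simpa using hv.ne)
    refine ⟨_, ⟨y, hy1, rfl⟩, htail y hy2, fun j => ?_⟩
    have hi0 : f i.succ y < f 0 y := by
      refine lt_of_le_of_ne (not_lt.1 fun h => ?_) fun h => (Fin.succ_ne_zero i) (hy1 h)
      have := hy3.1 h
      simp only [map_neg, neg_lt_neg_iff] at this
      exact lt_asymm hv this
    constructor
    · intro hj
      by_contra h
      push Not at h
      have h1 : f 0 u < f j.succ u := by
        rw [hu0]
        exact lt_of_le_of_ne h.2 fun h' => h.1 (hu h').symm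
      exact lt_asymm hj (hy2 _ _ h1)
    · rintro (rfl | h)
      · exact hi0
      · exact hy2 _ _ (h.trans_eq hu0.symm)

theorem exists_extension_of_mem_sweepOrders {f : Fin (n + 1) → V →ₗ[ℝ] ℝ}
    (hf : ∀ i : Fin n, f 0 ≠ f i.succ) {r : Fin n → Fin n → Prop}
    (hr : r ∈ sweepOrders fun j : Fin n => f j.succ) : ∃ s ∈ sweepOrders f, tailRel s = r := by
  obtain ⟨u, hu, rfl⟩ := hr
  by_cases h : ∃ i : Fin n, f 0 u = f i.succ u
  · obtain ⟨i, hi⟩ := h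
    obtain ⟨s, hs, h⟩ := (exists_extensions_of_mem_sweepOrdersOn (hf i)
      (mem_sweepOrdersOn.2 ⟨u, hi, hu, rfl⟩)).1
    exact ⟨s, hs.1, h⟩
  · push Not at h
    refine ⟨_, ⟨u, ?_, rfl⟩, rfl⟩
    intro k l
    refine Fin.cases ?_ (fun k => ?_) k <;> refine Fin.cases ?_ (fun l => ?_) l
    · intro _; rfl
    · intro h'; exact absurd h' (h l)
    · intro h'; exact absurd h'.symm (h k)
    · intro h'; exact congrArg Fin.succ (hu h')

/-- Among the extensions of an ordering, the one with most indices below `0` is not crossable. -/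
theorem exists_not_crossable_extension {f : Fin (n + 1) → V →ₗ[ℝ] ℝ}
    (hf : ∀ i : Fin n, f 0 ≠ f i.succ) {r : Fin n → Fin n → Prop}
    (hr : r ∈ sweepOrders fun j : Fin n => f j.succ) :
    ∃ s ∈ sweepOrders f \ ⋃ i, crossableOrders f i, tailRel s = r := by
  obtain ⟨s0, hs0, hs0r⟩ := exists_extension_of_mem_sweepOrders hf hr
  obtain ⟨s, ⟨hs, hsr⟩, hmax⟩ := Set.exists_max_image {s | s ∈ sweepOrders f ∧ tailRel s = r}
    (fun s => {j : Fin n | s j.succ 0}.ncard) (Set.toFinite _) ⟨s0, hs0, hs0r⟩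
  refine ⟨s, ⟨hs, fun hmem => ?_⟩, hsr⟩
  obtain ⟨i, hi⟩ := Set.mem_iUnion.1 hmem
  obtain ⟨s', hs', hs'r, hs'0⟩ := (exists_extensions_of_mem_sweepOrdersOn (hf i) hi.2.2.2).2
  refine absurd (hmax s' ⟨hs', hs'r.trans hsr⟩) (not_le.2 (Set.ncard_lt_ncard ?_ (Set.toFinite _)))
  obtain ⟨⟨u, hu, rfl⟩, h1, h2, -⟩ := hi
  refine ⟨fun j (hj : f j.succ u < f 0 u) => (hs'0 j).2 (Or.inr (hj.trans h1)), fun hsub => ?_⟩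
  exact lt_asymm h1 (hsub ((hs'0 i).2 (Or.inl rfl)))

theorem ncard_sweepOrders_succ_eq (f : Fin (n + 1) → V →ₗ[ℝ] ℝ)
    (hf : ∀ i : Fin n, f 0 ≠ f i.succ) :
    (sweepOrders f).ncard = (sweepOrders fun j : Fin n => f j.succ).ncard +
      ∑ i, (sweepOrdersOn f i).ncard := by
  refine le_antisymm (ncard_sweepOrders_succ_le f) ?_
  rw [ncard_sweepOrders_eq_add]
  refine add_le_add ?_ (Finset.sum_le_sum fun i _ => ?_)
  · refine (Set.ncard_le_ncard (t := tailRel '' (sweepOrders f \ ⋃ i, crossableOrders f i)) ?_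
      (Set.toFinite _)).trans (Set.ncard_image_le (Set.toFinite _))
    exact fun r hr => exists_not_crossable_extension hf hr
  · refine (Set.ncard_le_ncard (t := tailRel '' crossableOrders f i) ?_
      (Set.toFinite _)).trans (Set.ncard_image_le (Set.toFinite _))
    exact fun r hr => (exists_extensions_of_mem_sweepOrdersOn (hf i) hr).1

/-! ### The recursion for the number of orderings -/

/-- The number of orderings that `n` functionals in general position on a space of dimension `d`
induce, given by its recursion. -/
def genericSweepCount : ℕ → ℕ → ℕ
  | _, 0 => 1
  | 0, n + 1 => if n = 0 then 1 else 0
  | d + 1, n + 1 => genericSweepCount (d + 1) n + n * genericSweepCount d n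

/-- General position of a family of functionals, relative to a dimension `d`: no difference
`f k - f i` with `k < i` lies in the span of fewer than `d` differences of members with indices
larger than `k`. -/
def SweepGeneric {W : Type*} [AddCommGroup W] [Module ℝ W] (d : ℕ) (f : Fin n → W) : Prop :=
  ∀ k i, k < i → ∀ T : Finset (Fin n × Fin n), T.card < d → (∀ p ∈ T, k < p.1 ∧ k < p.2) →
    f k - f i ∉ Submodule.span ℝ ((fun p : Fin n × Fin n => f p.1 - f p.2) '' T)

theorem finrank_ker_of_ne_zero [FiniteDimensional ℝ V] {φ : V →ₗ[ℝ] ℝ} (hφ : φ ≠ 0) :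
    Module.finrank ℝ (LinearMap.ker φ) + 1 = Module.finrank ℝ V := by
  have h := LinearMap.finrank_range_add_finrank_ker φ
  rw [LinearMap.range_eq_top.2 (LinearMap.surjective hφ), finrank_top, Module.finrank_self] at h
  omega

theorem ncard_sweepOrders_of_finrank_eq_zero [FiniteDimensional ℝ V] (h : Module.finrank ℝ V = 0)
    (f : Fin (n + 1) → V →ₗ[ℝ] ℝ) : (sweepOrders f).ncard = genericSweepCount 0 (n + 1) := by
  have := Module.finrank_zero_iff.1 h
  rw [genericSweepCount]
  split_ifs with hn
  · subst hn
    rw [Set.ncard_eq_one]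
    refine ⟨fun i j => f i 0 < f j 0, Set.eq_singleton_iff_unique_mem.2 ⟨⟨0, ?_, rfl⟩, ?_⟩⟩
    · exact fun i j _ => Fin.ext (by omega)
    · rintro r ⟨u, -, rfl⟩
      rw [Subsingleton.elim u 0]
  · rw [Set.ncard_eq_zero]
    refine Set.eq_empty_of_forall_notMem ?_
    rintro r ⟨u, hu, -⟩
    rw [Subsingleton.elim u 0] at hu
    have : (0 : Fin (n + 1)) = Fin.last n := hu (by simp)
    exact hn (by simpa [Fin.ext_iff] using this.symm)

theorem ncard_sweepOrders_zero (f : Fin 0 → V →ₗ[ℝ] ℝ) : (sweepOrders f).ncard = 1 := by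
  rw [Set.ncard_eq_one]
  refine ⟨fun i _ => i.elim0, Set.eq_singleton_iff_unique_mem.2 ⟨⟨0, ?_, ?_⟩, ?_⟩⟩
  · exact Function.injective_of_subsingleton _
  · exact Subsingleton.elim _ _
  · exact fun _ _ => Subsingleton.elim _ _

theorem ncard_sweepOrders_le [FiniteDimensional ℝ V] (f : Fin n → V →ₗ[ℝ] ℝ) :
    (sweepOrders f).ncard ≤ genericSweepCount (Module.finrank ℝ V) n := by
  induction n generalizing V with
  | zero => rw [ncard_sweepOrders_zero, genericSweepCount]
  | succ n ih =>
    rcases hd : Module.finrank ℝ V with _ | d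
    · exact (ncard_sweepOrders_of_finrank_eq_zero hd f).le
    by_cases hf : ∃ i : Fin n, f 0 = f i.succ
    · obtain ⟨i, hi⟩ := hf
      rw [(Set.ncard_eq_zero).2]
      · exact Nat.zero_le _
      refine Set.eq_empty_of_forall_notMem ?_
      rintro r ⟨u, hu, -⟩
      exact (Fin.succ_ne_zero i) (hu (by simp [hi])).symm
    · push Not at hf
      refine (ncard_sweepOrders_succ_le f).trans ?_
      rw [genericSweepCount]
      refine add_le_add (hd ▸ ih _) ?_
      refine (Finset.sum_le_card_nsmul _ _ (genericSweepCount d n) fun i _ => ?_).trans (by simp)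
      have h := finrank_ker_of_ne_zero (sub_ne_zero.2 (hf i))
      refine (ih _).trans ?_
      rw [show Module.finrank ℝ (LinearMap.ker (f 0 - f i.succ)) = d by omega]

theorem SweepGeneric.tail {W : Type*} [AddCommGroup W] [Module ℝ W] {d : ℕ} {f : Fin (n + 1) → W}
    (hf : SweepGeneric d f) : SweepGeneric d (fun j : Fin n => f j.succ) := by
  classical
  intro k i hki T hT hkT hmem
  refine hf k.succ i.succ (Fin.succ_lt_succ_iff.2 hki)
    (T.image fun p => (p.1.succ, p.2.succ)) (Finset.card_image_le.trans_lt hT) ?_ ?_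
  · simp only [Finset.mem_image]
    rintro p ⟨q, hq, rfl⟩
    exact ⟨Fin.succ_lt_succ_iff.2 (hkT q hq).1, Fin.succ_lt_succ_iff.2 (hkT q hq).2⟩
  · rw [Finset.coe_image, Set.image_image]
    exact hmem

/-- Restricting the other functionals to the hyperplane on which the first one agrees with
`f i.succ` preserves general position, with the dimension lowered by one: a relation among the
restrictions lifts to a relation that may also involve `f 0 - f i.succ`, and solving for that
difference would contradict the genericity of `f 0`. -/
theorem SweepGeneric.domRestrict {d : ℕ} {f : Fin (n + 1) → V →ₗ[ℝ] ℝ}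
    (hf : SweepGeneric (d + 1) f) (i : Fin n) : SweepGeneric d
      (fun j : Fin n => (f j.succ).domRestrict (LinearMap.ker (f 0 - f i.succ))) := by
  classical
  intro k l hkl T hT hkT hmem
  set φ := f 0 - f i.succ with hφ
  set R : (V →ₗ[ℝ] ℝ) →ₗ[ℝ] (LinearMap.ker φ →ₗ[ℝ] ℝ) :=
    LinearMap.lcomp ℝ ℝ (LinearMap.ker φ).subtype with hR
  have hRapp : ∀ g, R g = g.domRestrict (LinearMap.ker φ) := fun g => rfl
  have himg : ((fun p : Fin n × Fin n => (f p.1.succ).domRestrict (LinearMap.ker φ) -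
      (f p.2.succ).domRestrict (LinearMap.ker φ)) '' T) =
      R '' ((fun p : Fin n × Fin n => f p.1.succ - f p.2.succ) '' T) := by
    rw [Set.image_image]
    refine Set.image_congr fun p _ => ?_
    rw [map_sub]; rfl
  rw [himg, Submodule.span_image] at hmem
  obtain ⟨t, ht, htR⟩ := hmem
  have hker : R (f k.succ - f l.succ - t) = 0 := by
    rw [map_sub, htR, map_sub]; exact sub_self _
  have hle : LinearMap.ker φ ≤ LinearMap.ker (f k.succ - f l.succ - t) := fun x hx => by
    have := LinearMap.congr_fun hker ⟨x, hx⟩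
    exact this
  obtain ⟨c, hc⟩ : ∃ c : ℝ, c • φ = f k.succ - f l.succ - t := by
    have := (mem_span_of_iInf_ker_le_ker (L := fun _ : Unit => φ)
      (K := f k.succ - f l.succ - t) (by simpa using hle))
    rw [Set.range_const] at this
    exact Submodule.mem_span_singleton.1 this
  have hinj : (fun p : Fin (n + 1) × Fin (n + 1) => f p.1 - f p.2) ''
      ((T.image fun p => (p.1.succ, p.2.succ) : Finset (Fin (n + 1) × Fin (n + 1))) :
        Set (Fin (n + 1) × Fin (n + 1))) =
      (fun p : Fin n × Fin n => f p.1.succ - f p.2.succ) '' T := by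
    rw [Finset.coe_image, Set.image_image]
  by_cases hc0 : c = 0
  · rw [hc0, zero_smul] at hc
    refine hf.tail k l hkl T (by omega) hkT ?_
    rw [sub_eq_zero.1 hc.symm]
    exact ht
  · refine hf 0 i.succ (Fin.succ_pos i)
      (insert (k.succ, l.succ) (T.image fun p => (p.1.succ, p.2.succ))) ?_ ?_ ?_
    · have h1 := Finset.card_insert_le ((k.succ, l.succ) : Fin (n + 1) × Fin (n + 1))
        (T.image fun p => (p.1.succ, p.2.succ))
      have h2 : (T.image fun p => (p.1.succ, p.2.succ)).card ≤ T.card := Finset.card_image_le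
      omega
    · simp only [Finset.mem_insert, Finset.mem_image]
      rintro p (rfl | ⟨q, -, rfl⟩) <;> exact ⟨Fin.succ_pos _, Fin.succ_pos _⟩
    · rw [Finset.coe_insert, Set.image_insert_eq, hinj, ← hφ,
        show φ = c⁻¹ • ((f k.succ - f l.succ) - t) by
          rw [← hc, smul_smul, inv_mul_cancel₀ hc0, one_smul]]
      refine Submodule.smul_mem _ _ (Submodule.sub_mem _ ?_ ?_)
      · exact Submodule.subset_span (Set.mem_insert _ _)
      · exact Submodule.span_mono (Set.subset_insert _ _) ht

/-- General position passes to both terms of the recursion, so that the recursive inequality is an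
equality at every step. -/
theorem SweepGeneric.ncard_sweepOrders [FiniteDimensional ℝ V] {f : Fin n → V →ₗ[ℝ] ℝ}
    (hf : SweepGeneric (Module.finrank ℝ V) f) :
    (sweepOrders f).ncard = genericSweepCount (Module.finrank ℝ V) n := by
  induction n generalizing V with
  | zero => rw [ncard_sweepOrders_zero, genericSweepCount]
  | succ n ih =>
    rcases hd : Module.finrank ℝ V with _ | d
    · exact ncard_sweepOrders_of_finrank_eq_zero hd f
    have hne : ∀ i : Fin n, f 0 ≠ f i.succ := fun i h =>
      hf 0 i.succ (Fin.succ_pos i) ∅ (by simp [hd]) (by simp) (by simp [h])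
    rw [ncard_sweepOrders_succ_eq f hne, genericSweepCount, ih hf.tail, hd]
    congr 1
    rw [Finset.sum_congr rfl fun i _ => ?_, Finset.sum_const, Finset.card_univ, Fintype.card_fin,
      smul_eq_mul]
    have h := finrank_ker_of_ne_zero (sub_ne_zero.2 (hne i))
    have h' : Module.finrank ℝ (LinearMap.ker (f 0 - f i.succ)) = d := by omega
    rw [sweepOrdersOn, ih, h']
    rw [h']
    rw [hd] at hf
    exact hf.domRestrict i

end Sweep

/-! ### The recursion for sums of Stirling numbers -/

theorem genericSweepCount_zero_left {m : ℕ} (hm : 2 ≤ m) : genericSweepCount 0 m = 0 := by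
  obtain ⟨m, rfl⟩ := Nat.exists_eq_add_of_le' hm
  simp [genericSweepCount]

/-- From two elements on, as many permutations have an even number of cycles as an odd number. -/
theorem sum_stirlingFirst_even_eq_odd {m : ℕ} (hm : 2 ≤ m) {K : ℕ} (hK : m ≤ K) :
    ∑ j ∈ Finset.range (K + 1), Nat.stirlingFirst m (2 * j) =
      ∑ j ∈ Finset.range (K + 1), Nat.stirlingFirst m (2 * j + 1) := by
  induction m, hm using Nat.le_induction with
  | base =>
    have h0 : ∀ j ∈ Finset.range (K + 1), j ≠ 1 → Nat.stirlingFirst 2 (2 * j) = 0 := by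
      intro j _ hj
      rcases Nat.eq_zero_or_pos j with rfl | h
      · rfl
      · exact Nat.stirlingFirst_eq_zero_of_lt (by omega)
    have h1 : ∀ j ∈ Finset.range (K + 1), j ≠ 0 → Nat.stirlingFirst 2 (2 * j + 1) = 0 :=
      fun j _ hj => Nat.stirlingFirst_eq_zero_of_lt (by omega)
    rw [Finset.sum_eq_single_of_mem 1 (by simp; omega) h0,
      Finset.sum_eq_single_of_mem 0 (by simp) h1]
    rfl
  | succ m hm ih =>
    have ih := ih (by omega)
    have hodd : ∑ j ∈ Finset.range (K + 1), Nat.stirlingFirst (m + 1) (2 * j + 1) =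
        m * ∑ j ∈ Finset.range (K + 1), Nat.stirlingFirst m (2 * j + 1) +
          ∑ j ∈ Finset.range (K + 1), Nat.stirlingFirst m (2 * j) := by
      rw [Finset.mul_sum, ← Finset.sum_add_distrib]
      exact Finset.sum_congr rfl fun j _ => Nat.stirlingFirst_succ_succ _ _
    have heven : ∑ j ∈ Finset.range (K + 1), Nat.stirlingFirst (m + 1) (2 * j) =
        m * ∑ j ∈ Finset.range (K + 1), Nat.stirlingFirst m (2 * j) +
          ∑ j ∈ Finset.range (K + 1), Nat.stirlingFirst m (2 * j + 1) := by
      have hlast : Nat.stirlingFirst m (2 * K + 1) = 0 :=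
        Nat.stirlingFirst_eq_zero_of_lt (by omega)
      have hfirst : Nat.stirlingFirst m (2 * 0) = 0 := by
        obtain ⟨k, rfl⟩ := Nat.exists_eq_add_of_le' hm
        rfl
      rw [Finset.sum_range_succ' _ K, Finset.sum_range_succ' _ K, hfirst,
        Finset.sum_range_succ _ K, hlast, add_zero, add_zero, Finset.mul_sum, mul_zero,
        Nat.stirlingFirst_succ_zero, add_zero, ← Finset.sum_add_distrib]
      exact Finset.sum_congr rfl fun j _ => Nat.stirlingFirst_succ_succ _ _
    rw [hodd, heven, ih]

theorem lineShellingBound_eq_sum {d m K : ℕ} (hdm : d ≤ m) (hK : d ≤ K) :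
    lineShellingBound d m = 2 * ∑ j ∈ Finset.range K, Nat.stirlingFirst m (m - d + 1 + 2 * j) := by
  rw [lineShellingBound]
  congr 1
  refine Finset.sum_subset (Finset.range_subset_range.2 hK) fun j _ hj => ?_
  have := Finset.mem_range.not.1 hj
  exact Nat.stirlingFirst_eq_zero_of_lt (by omega)

theorem lineShellingBound_of_le {d m : ℕ} (hmd : m ≤ d) :
    lineShellingBound d m = lineShellingBound m m := by
  rw [lineShellingBound_eq_sum le_rfl hmd, lineShellingBound, Nat.sub_eq_zero_of_le hmd,
    Nat.sub_self]

theorem lineShellingBound_one {m : ℕ} (hm : 1 ≤ m) : lineShellingBound 1 m = 2 := by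
  simp [lineShellingBound, Nat.sub_add_cancel hm, Nat.stirlingFirst_self]

theorem lineShellingBound_succ_succ {d m : ℕ} (hm : 2 ≤ m) :
    lineShellingBound (d + 1) (m + 1) =
      lineShellingBound (d + 1) m + m * lineShellingBound d m := by
  rcases le_or_gt m d with hmd | hmd
  · rw [lineShellingBound_of_le (by omega : m + 1 ≤ d + 1), lineShellingBound_of_le hmd,
      lineShellingBound_of_le (by omega : m ≤ d + 1),
      lineShellingBound_eq_sum le_rfl le_rfl, lineShellingBound_eq_sum le_rfl (Nat.le_succ m)]
    have h := sum_stirlingFirst_even_eq_odd hm le_rfl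
    have h1 : ∀ j, Nat.stirlingFirst (m + 1) (m + 1 - (m + 1) + 1 + 2 * j) =
        m * Nat.stirlingFirst m (2 * j + 1) + Nat.stirlingFirst m (2 * j) := fun j => by
      rw [← Nat.stirlingFirst_succ_succ]; congr 1; omega
    have h2 : ∀ j, Nat.stirlingFirst m (m - m + 1 + 2 * j) = Nat.stirlingFirst m (2 * j + 1) :=
      fun j => by congr 1; omega
    simp only [h1, h2, Finset.sum_add_distrib, ← Finset.mul_sum, h]
    ring
  · rw [lineShellingBound_eq_sum (by omega : d + 1 ≤ m + 1) le_rfl,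
      lineShellingBound_eq_sum (by omega : d + 1 ≤ m) le_rfl,
      lineShellingBound_eq_sum hmd.le (Nat.le_succ d)]
    have h1 : ∀ j, Nat.stirlingFirst (m + 1) (m + 1 - (d + 1) + 1 + 2 * j) =
        m * Nat.stirlingFirst m (m - d + 1 + 2 * j) +
          Nat.stirlingFirst m (m - (d + 1) + 1 + 2 * j) := fun j => by
      have e1 : m + 1 - (d + 1) + 1 + 2 * j = (m - (d + 1) + 1 + 2 * j) + 1 := by omega
      have e2 : m - d + 1 + 2 * j = (m - (d + 1) + 1 + 2 * j) + 1 := by omega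
      rw [e1, e2, Nat.stirlingFirst_succ_succ]
    simp only [h1, Finset.sum_add_distrib, ← Finset.mul_sum]
    ring

theorem genericSweepCount_one_right (d : ℕ) : genericSweepCount d 1 = 1 := by
  cases d <;> simp [genericSweepCount]

theorem genericSweepCount_eq_lineShellingBound {d m : ℕ} (hd : 1 ≤ d) (hm : 2 ≤ m) :
    genericSweepCount d m = lineShellingBound d m := by
  induction m, hm using Nat.le_induction generalizing d with
  | base =>
    obtain ⟨d, rfl⟩ := Nat.exists_eq_add_of_le' hd
    have h : genericSweepCount (d + 1) 2 = 2 := by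
      rw [genericSweepCount, genericSweepCount_one_right, genericSweepCount_one_right]
    rw [h]
    rcases Nat.eq_zero_or_pos d with rfl | hd
    · rfl
    · rw [lineShellingBound_of_le (by omega)]; rfl
  | succ m hm ih =>
    obtain ⟨d, rfl⟩ := Nat.exists_eq_add_of_le' hd
    rw [genericSweepCount, ih hd]
    rcases Nat.eq_zero_or_pos d with rfl | hd
    · rw [zero_add, genericSweepCount_zero_left hm, lineShellingBound_one (by omega),
        lineShellingBound_one (by omega), mul_zero, add_zero]
    · rw [ih hd, lineShellingBound_succ_succ hm]

/-! ### Facets as functionals and line shellings as orderings -/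

section Facets

variable {E : Type*} [NormedAddCommGroup E] [NormedSpace ℝ E]

theorem travelsBefore_inv_iff {x y : ℝ} (hx : x ≠ 0) (hy : y ≠ 0) :
    TravelsBefore x⁻¹ y⁻¹ ↔ y < x := by
  unfold TravelsBefore
  rcases lt_or_gt_of_ne hx with hx | hx <;> rcases lt_or_gt_of_ne hy with hy | hy
  · rw [inv_lt_inv_of_neg hx hy, inv_pos, inv_lt_zero]
    constructor
    · rintro (h | h | h) <;> linarith
    · exact fun h => Or.inr (Or.inr ⟨h, hy⟩)
  · simp only [inv_pos, inv_lt_zero]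
    constructor
    · rintro (h | h | h) <;> linarith
    · intro h; linarith
  · simp only [inv_pos, inv_lt_zero]
    exact ⟨fun _ => hy.trans hx, fun _ => Or.inr (Or.inl ⟨hx, hy⟩)⟩
  · rw [inv_lt_inv₀ hx hy, inv_pos, inv_lt_zero]
    constructor
    · rintro (h | h | h) <;> linarith
    · exact fun h => Or.inl ⟨hx, h⟩

theorem mem_affineSubspace_iff_of_finrank [FiniteDimensional ℝ E] {A : AffineSubspace ℝ E}
    {φ : E →ₗ[ℝ] ℝ} {p : E} (hne : (A : Set E).Nonempty) (hA : ∀ x ∈ A, φ (x - p) = 1)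
    (hdim : Module.finrank ℝ A.direction + 1 = Module.finrank ℝ E) (x : E) :
    x ∈ A ↔ φ (x - p) = 1 := by
  obtain ⟨x₀, hx₀⟩ := hne
  have hφ : φ ≠ 0 := fun h => by simpa [h] using hA x₀ hx₀
  have hle : A.direction ≤ LinearMap.ker φ := by
    intro v hv
    have h := hA _ (AffineSubspace.vadd_mem_of_mem_direction hv hx₀)
    have h' := hA _ hx₀
    simp only [vadd_eq_add, add_sub_assoc, map_add, h'] at h
    simpa using h
  have heq : A.direction = LinearMap.ker φ :=
    Submodule.eq_of_le_of_finrank_eq hle (by have := finrank_ker_of_ne_zero hφ; omega)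
  rw [← AffineSubspace.vsub_right_mem_direction_iff_mem hx₀, heq, LinearMap.mem_ker, vsub_eq_sub]
  have h' := hA _ hx₀
  rw [map_sub] at h' ⊢
  rw [map_sub]
  constructor <;> intro h <;> linarith

theorem apply_eq_of_mem_affineSpan {F : Set E} {φ : E →ₗ[ℝ] ℝ} {c : ℝ} (h : ∀ x ∈ F, φ x = c)
    {x : E} (hx : x ∈ affineSpan ℝ F) : φ x = c := by
  refine affineSpan_induction (p := fun x => φ x = c) hx h ?_
  intro c u v w hu hv hw
  simp [hu, hv, hw]

theorem finrank_direction_of_mem_interior {P : Set E} {p : E} (hp : p ∈ interior P) :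
    Module.finrank ℝ (affineSpan ℝ P).direction = Module.finrank ℝ E := by
  rw [affineSpan_eq_top_of_nonempty_interior ⟨p, interior_mono (subset_convexHull ℝ P) hp⟩,
    AffineSubspace.direction_top, finrank_top]

/-- A nonzero functional does not attain its maximum over a set at an interior point. -/
theorem exists_lt_of_mem_interior {P : Set E} {p : E} (hp : p ∈ interior P) {l : E →L[ℝ] ℝ}
    (hl : l ≠ 0) : ∃ y ∈ P, l p < l y := by
  by_contra! h
  have hmax : IsLocalMax l p := by
    filter_upwards [mem_interior_iff_mem_nhds.1 hp] with y hy using h y hy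
  exact hl (hmax.hasFDerivAt_eq_zero l.hasFDerivAt)

/-- The affine span of a facet is a hyperplane missing the interior point `p`, so it has an
equation `a (x - p) = 1`. -/
theorem exists_functional_of_mem_polytopeFacets [FiniteDimensional ℝ E] {P F : Set E} {p : E}
    (hp : p ∈ interior P) (hF : F ∈ polytopeFacets P) :
    ∃ a : E →ₗ[ℝ] ℝ, ∀ x, x ∈ affineSpan ℝ F ↔ a (x - p) = 1 := by
  obtain ⟨hne, hexp, hdim⟩ := hF
  rw [finrank_direction_of_mem_interior hp] at hdim
  obtain ⟨l, rfl⟩ := hexp hne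
  obtain ⟨x₀, hx₀, hmax⟩ := hne
  have hl : l ≠ 0 := by
    rintro rfl
    rw [show {x | x ∈ P ∧ ∀ y ∈ P, (0 : E →L[ℝ] ℝ) y ≤ (0 : E →L[ℝ] ℝ) x} = P by ext; simp,
      finrank_direction_of_mem_interior hp] at hdim
    omega
  obtain ⟨y, hy, hpy⟩ := exists_lt_of_mem_interior hp hl
  have hpos : 0 < l x₀ - l p := by linarith [hmax y hy]
  refine ⟨(l x₀ - l p)⁻¹ • (l : E →ₗ[ℝ] ℝ), mem_affineSubspace_iff_of_finrank ?_ ?_ hdim⟩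
  · exact ⟨x₀, subset_affineSpan ℝ _ ⟨hx₀, hmax⟩⟩
  · intro x hx
    replace hx : l x = l x₀ := apply_eq_of_mem_affineSpan (φ := (l : E →ₗ[ℝ] ℝ))
      (fun z hz => le_antisymm (hmax z hz.1) (hz.2 x₀ hx₀)) hx
    simp only [LinearMap.smul_apply, ContinuousLinearMap.coe_coe, map_sub, hx, smul_eq_mul]
    rw [← mul_sub, inv_mul_cancel₀ hpos.ne']

theorem mem_iff_mem_affineSpan_of_mem_polytopeFacets {P F : Set E} (hF : F ∈ polytopeFacets P)
    (x : E) : x ∈ F ↔ x ∈ P ∧ x ∈ affineSpan ℝ F := by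
  obtain ⟨hne, hexp, -⟩ := hF
  refine ⟨fun hx => ⟨hexp.subset hx, subset_affineSpan ℝ _ hx⟩, ?_⟩
  rintro ⟨hxP, hx⟩
  obtain ⟨l, rfl⟩ := hexp hne
  obtain ⟨x₀, hx₀, hmax⟩ := hne
  have hlx : l x = l x₀ := apply_eq_of_mem_affineSpan (φ := (l : E →ₗ[ℝ] ℝ))
    (fun z hz => le_antisymm (hmax z hz.1) (hz.2 x₀ hx₀)) hx
  exact ⟨hxP, fun y hy => (hmax y hy).trans_eq hlx.symm⟩

/-- For a listing `F` of the sets `e 0, …, e (m - 1)`, the relation "`e i` is listed after `e j`"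
on indices. -/
def listedAfter {α : Type*} {m : ℕ} (e F : Fin m → α) : Fin m → Fin m → Prop :=
  fun i j => ∃ k l, l < k ∧ F k = e i ∧ F l = e j

theorem listedAfter_comp {α : Type*} {m : ℕ} {e : Fin m → α} (he : Function.Injective e)
    (σ : Equiv.Perm (Fin m)) (i j : Fin m) :
    listedAfter e (e ∘ σ) i j ↔ σ.symm j < σ.symm i := by
  constructor
  · rintro ⟨k, l, hlk, hk, hl⟩
    rwa [← he hk, ← he hl, σ.symm_apply_apply, σ.symm_apply_apply]
  · intro h
    exact ⟨_, _, h, by simp, by simp⟩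

theorem exists_perm_of_range_eq {α : Type*} {m : ℕ} {e F : Fin m → α} (he : Function.Injective e)
    (h : Set.range F = Set.range e) : ∃ σ : Equiv.Perm (Fin m), F = e ∘ σ := by
  choose σ hσ using fun k => (h ▸ Set.mem_range_self k : F k ∈ Set.range e)
  have hsurj : Function.Surjective σ := fun i => by
    obtain ⟨k, hk⟩ := (h ▸ Set.mem_range_self i : e i ∈ Set.range F)
    exact ⟨k, he ((hσ k).trans hk)⟩
  exact ⟨Equiv.ofBijective σ (Finite.surjective_iff_bijective.1 hsurj), funext fun k => (hσ k).symm⟩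

theorem perm_eq_of_listedAfter_eq {α : Type*} {m : ℕ} {e : Fin m → α} (he : Function.Injective e)
    {σ τ : Equiv.Perm (Fin m)} (h : listedAfter e (e ∘ σ) = listedAfter e (e ∘ τ)) : σ = τ := by
  have hmono : StrictMono fun k => τ.symm (σ k) := fun k l hkl => by
    rw [← listedAfter_comp he, ← h, listedAfter_comp he]
    simpa using hkl
  have hid : (fun k => τ.symm (σ k)) = id := by
    refine (StrictMono.range_inj hmono strictMono_id).1 ?_
    rw [Set.range_id, Set.range_eq_univ]
    exact τ.symm.surjective.comp σ.surjective
  ext k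
  have := congrFun hid k
  rw [id, Equiv.symm_apply_eq] at this
  rw [this]

/-- The ordering of the facets met along the line through `p` with direction `u` is the ordering
of the functionals `a i` by decreasing value at `u`, since the line meets the affine span of the
facet `e i` at the parameter `(a i u)⁻¹`. -/
theorem isLineShelling_iff {P : Set E} {p : E} {m : ℕ} {e : Fin m → Set E}
    (hrange : Set.range e = polytopeFacets P) {a : Fin m → E →ₗ[ℝ] ℝ}
    (ha : ∀ i x, x ∈ affineSpan ℝ (e i) ↔ a i (x - p) = 1) (hm : 0 < m)
    (σ : Equiv.Perm (Fin m)) :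
    IsLineShelling P p (e ∘ σ) ↔ ∃ u, (∀ i, a i u ≠ 0) ∧ StrictAnti fun k => a (σ k) u := by
  have hmem : ∀ (i : Fin m) (u : E) (s : ℝ), p + s • u ∈ affineSpan ℝ (e i) ↔ s * a i u = 1 :=
    fun i u s => by rw [ha, add_sub_cancel_left, map_smul, smul_eq_mul]
  constructor
  · rintro ⟨-, u, t, -, ht, hlt⟩
    have ht1 : ∀ i, t i * a (σ i) u = 1 := fun i => (hmem _ _ _).1 ((ht i _).2 rfl)
    have hne : ∀ i, a (σ i) u ≠ 0 := fun i => right_ne_zero_of_mul_eq_one (ht1 i)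
    refine ⟨u, fun i => by simpa using hne (σ.symm i), fun i j hij => ?_⟩
    have h := hlt i j hij
    rwa [eq_inv_of_mul_eq_one_left (ht1 i), eq_inv_of_mul_eq_one_left (ht1 j),
      travelsBefore_inv_iff (hne i) (hne j)] at h
  · rintro ⟨u, hne, hanti⟩
    refine ⟨?_, u, fun i => (a (σ i) u)⁻¹, ?_, fun i s => ?_, fun i j hij => ?_⟩
    · rw [← hrange, Set.range_comp, σ.range_eq_univ, Set.image_univ]
    · rintro rfl
      exact hne ⟨0, hm⟩ (map_zero _)
    · exact (hmem _ _ _).trans (mul_eq_one_iff_eq_inv₀ (hne _))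
    · exact (travelsBefore_inv_iff (hne _) (hne _)).2 (hanti hij)

/-- Every ordering by the values of nonzero functionals is induced at a point where none of them
vanishes. -/
theorem exists_apply_ne_zero_of_mem_sweepOrders {m : ℕ} {a : Fin m → E →ₗ[ℝ] ℝ}
    (ha : ∀ i, a i ≠ 0) {r : Fin m → Fin m → Prop} (hr : r ∈ sweepOrders a) :
    ∃ u, (∀ i, a i u ≠ 0) ∧ Function.Injective (fun i => a i u) ∧
      r = fun i j => a i u < a j u := by
  obtain ⟨u, hu, rfl⟩ := hr
  obtain ⟨v, hv⟩ := Module.Dual.exists_forall_ne_zero_of_forall_exists a fun i =>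
    not_forall.1 fun h => ha i (LinearMap.ext h)
  -- adjoining the zero functional makes the displacement preserve signs as well
  obtain ⟨ε, hε, hlt⟩ := exists_pos_forall_lt (fun o : Option (Fin m) => o.elim 0 a) u v
  have hlt' : ∀ i j, a i u < a j u → a i (u + ε • v) < a j (u + ε • v) :=
    fun i j => hlt (some i) (some j)
  refine ⟨u + ε • v, fun i => ?_, injective_of_forall_lt hu hlt', ?_⟩
  · rcases lt_trichotomy (a i u) 0 with h | h | h
    · exact (hlt (some i) none h).ne
    · rw [map_add, map_smul, h, zero_add, smul_eq_mul]
      exact mul_ne_zero hε.ne' (hv i)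
    · exact (hlt none (some i) h).ne'
  · funext i j
    exact propext (lt_iff_of_forall_lt hu hlt' i j)

theorem exists_perm_strictAnti {m : ℕ} {g : Fin m → ℝ} (hg : Function.Injective g) :
    ∃ σ : Equiv.Perm (Fin m), StrictAnti fun k => g (σ k) := by
  refine ⟨Tuple.sort (fun i => -g i), fun k l hkl => ?_⟩
  have h := Tuple.monotone_sort (fun i => -g i) hkl.le
  simp only [Function.comp_apply, neg_le_neg_iff] at h
  exact lt_of_le_of_ne h fun h' => hkl.ne' ((Tuple.sort _).injective (hg h'))

theorem encard_lineShellings {P : Set E} {p : E} {m : ℕ} {e : Fin m → Set E}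
    (he : Function.Injective e) (hrange : Set.range e = polytopeFacets P) (hm : 0 < m)
    {a : Fin m → E →ₗ[ℝ] ℝ} (ha : ∀ i x, x ∈ affineSpan ℝ (e i) ↔ a i (x - p) = 1) :
    (lineShellings P p m).encard = (sweepOrders a).encard := by
  have ha0 : ∀ i, a i ≠ 0 := fun i h => by
    have hi : e i ∈ polytopeFacets P := hrange ▸ Set.mem_range_self i
    obtain ⟨x, hx⟩ := hi.1
    simpa [h] using (ha i x).1 (subset_affineSpan ℝ _ hx)
  have hrel : ∀ (σ : Equiv.Perm (Fin m)) (u : E), (StrictAnti fun k => a (σ k) u) →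
      listedAfter e (e ∘ σ) = fun i j => a i u < a j u := fun σ u hanti => by
    funext i j
    rw [listedAfter_comp he, ← hanti.lt_iff_gt]
    simp
  have hinj : Set.InjOn (listedAfter e) (lineShellings P p m) := by
    intro F hF G hG h
    obtain ⟨σ, rfl⟩ := exists_perm_of_range_eq he (hF.1.trans hrange.symm)
    obtain ⟨τ, rfl⟩ := exists_perm_of_range_eq he (hG.1.trans hrange.symm)
    rw [perm_eq_of_listedAfter_eq he h]
  rw [← hinj.encard_image]
  congr 1
  ext r
  constructor
  · rintro ⟨F, hF, rfl⟩
    obtain ⟨σ, rfl⟩ := exists_perm_of_range_eq he (hF.1.trans hrange.symm)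
    obtain ⟨u, -, hanti⟩ := (isLineShelling_iff hrange ha hm σ).1 hF
    refine ⟨u, ?_, hrel σ u hanti⟩
    have := hanti.injective.comp σ.symm.injective
    simpa [Function.comp_def] using this
  · intro hr
    obtain ⟨u, hu0, hu, rfl⟩ := exists_apply_ne_zero_of_mem_sweepOrders ha0 hr
    obtain ⟨σ, hσ⟩ := exists_perm_strictAnti hu
    exact ⟨e ∘ σ, (isLineShelling_iff hrange ha hm σ).2 ⟨u, hu0, hσ⟩, hrel σ u hσ⟩

end Facets

/-! ### Polar polyhedra -/

section DualPolyhedron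

open scoped InnerProductSpace

variable {E : Type*} [NormedAddCommGroup E] [InnerProductSpace ℝ E]

/-- The polyhedron cut out by the inequalities `⟪a i, x⟫ ≤ 1`, the polar of the points `a i`. -/
def dualPolyhedron {ι : Type*} (a : ι → E) : Set E :=
  {x | ∀ i, ⟪a i, x⟫_ℝ ≤ 1}

theorem isClosed_dualPolyhedron {ι : Type*} (a : ι → E) : IsClosed (dualPolyhedron a) := by
  have : dualPolyhedron a = ⋂ i, {x | ⟪a i, x⟫_ℝ ≤ 1} := by ext; simp [dualPolyhedron]
  rw [this]
  exact isClosed_iInter fun i => isClosed_le (by fun_prop) continuous_const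

theorem convex_dualPolyhedron {ι : Type*} (a : ι → E) : Convex ℝ (dualPolyhedron a) := by
  have : dualPolyhedron a = ⋂ i, {x | innerₗ E (a i) x ≤ 1} := by ext; simp [dualPolyhedron]
  rw [this]
  exact convex_iInter fun i => convex_halfSpace_le (innerₗ E (a i)).isLinear 1

theorem mem_interior_dualPolyhedron {ι : Type*} [Finite ι] {a : ι → E} {x : E}
    (hx : ∀ i, ⟪a i, x⟫_ℝ < 1) : x ∈ interior (dualPolyhedron a) := by
  rw [mem_interior_iff_mem_nhds]
  have h : ∀ᶠ y in nhds x, ∀ i, ⟪a i, y⟫_ℝ < 1 := Filter.eventually_all.2 fun i =>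
    ContinuousAt.eventually_lt (by fun_prop) continuousAt_const (hx i)
  exact Filter.mem_of_superset h fun y hy i => (hy i).le

/-- At an extreme point of a polyhedron no direction is orthogonal to all active constraints. -/
theorem eq_zero_of_mem_extremePoints_dualPolyhedron {ι : Type*} [Finite ι] {a : ι → E} {x v : E}
    (hx : x ∈ (dualPolyhedron a).extremePoints ℝ)
    (hv : ∀ i, ⟪a i, x⟫_ℝ = 1 → ⟪a i, v⟫_ℝ = 0) : v = 0 := by
  have h : ∀ᶠ ε : ℝ in nhds 0, ∀ i, ⟪a i, x⟫_ℝ < 1 →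
      ⟪a i, x + ε • v⟫_ℝ < 1 ∧ ⟪a i, x - ε • v⟫_ℝ < 1 := by
    refine Filter.eventually_all.2 fun i => ?_
    by_cases hi : ⟪a i, x⟫_ℝ < 1
    · have h1 : ∀ᶠ ε : ℝ in nhds 0, ⟪a i, x + ε • v⟫_ℝ < 1 :=
        ContinuousAt.eventually_lt (by fun_prop) continuousAt_const (by simpa using hi)
      have h2 : ∀ᶠ ε : ℝ in nhds 0, ⟪a i, x - ε • v⟫_ℝ < 1 :=
        ContinuousAt.eventually_lt (by fun_prop) continuousAt_const (by simpa using hi)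
      filter_upwards [h1, h2] with ε h1 h2 _ using ⟨h1, h2⟩
    · exact Filter.Eventually.of_forall fun ε h => absurd h hi
  obtain ⟨δ, hδ, h⟩ := Metric.eventually_nhds_iff.1 h
  have hε : 0 < δ / 2 := by positivity
  have h := h (y := δ / 2) (by simp [abs_of_pos hδ, hδ])
  have hmem : x + (δ / 2) • v ∈ dualPolyhedron a ∧ x - (δ / 2) • v ∈ dualPolyhedron a := by
    constructor <;> intro i <;> rcases (hx.1 i).lt_or_eq with hi | hi
    · exact (h i hi).1.le
    · rw [inner_add_right, inner_smul_right, hv i hi, hi]; simp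
    · exact (h i hi).2.le
    · rw [inner_sub_right, inner_smul_right, hv i hi, hi]; simp
  have heq := hx.2 hmem.1 hmem.2 ⟨1 / 2, 1 / 2, by norm_num, by norm_num, by norm_num, by module⟩
  have : (δ / 2) • v = 0 := by simpa using heq
  exact (smul_eq_zero.1 this).resolve_left hε.ne'

theorem finite_extremePoints_dualPolyhedron {ι : Type*} [Finite ι] (a : ι → E) :
    ((dualPolyhedron a).extremePoints ℝ).Finite := by
  -- an extreme point is determined by its set of active constraints
  refine Set.Finite.of_finite_image (f := fun x => {i | ⟪a i, x⟫_ℝ = 1}) (Set.toFinite _) ?_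
  intro x hx y hy hxy
  refine sub_eq_zero.1 (eq_zero_of_mem_extremePoints_dualPolyhedron hx fun i hi => ?_)
  have hi' : ⟪a i, y⟫_ℝ = 1 := (Set.ext_iff.1 hxy i).1 hi
  rw [inner_sub_right, hi, hi', sub_self]

theorem isConvexPolytope_dualPolyhedron {ι : Type*} [Finite ι] {a : ι → E}
    (h : IsCompact (dualPolyhedron a)) : IsConvexPolytope (dualPolyhedron a) := by
  have hfin := finite_extremePoints_dualPolyhedron a
  refine ⟨hfin.toFinset, ?_⟩
  rw [hfin.coe_toFinset, ← (hfin.isClosed_convexHull ℝ).closure_eq,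
    closure_convexHull_extremePoints h (convex_dualPolyhedron a)]

variable [FiniteDimensional ℝ E]

/-- A supporting hyperplane cuts out a facet if the vectors from `p` to the contact points span. -/
theorem mem_polytopeFacets_of_span {P : Set E} {p a : E} (hp : p ∈ interior P)
    (hP : ∀ y ∈ P, ⟪a, y - p⟫_ℝ ≤ 1) (hne : ∃ y ∈ P, ⟪a, y - p⟫_ℝ = 1)
    (hspan : ∀ w : E, (∀ y ∈ P, ⟪a, y - p⟫_ℝ = 1 → ⟪y - p, w⟫_ℝ = 0) → w = 0) :
    {y ∈ P | ⟪a, y - p⟫_ℝ = 1} ∈ polytopeFacets P := by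
  obtain ⟨y₀, hy₀, hy₀1⟩ := hne
  refine ⟨⟨y₀, hy₀, hy₀1⟩, fun _ => ⟨innerSL ℝ a, ?_⟩, ?_⟩
  · ext y
    simp only [Set.mem_ofPred_eq, innerSL_apply_apply]
    refine and_congr_right fun hy => ?_
    simp only [inner_sub_right] at hP hy₀1 ⊢
    constructor
    · intro h z hz
      linarith [hP z hz]
    · intro h
      linarith [h y₀ hy₀, hP y hy]
  · rw [finrank_direction_of_mem_interior hp]
    set F := {y ∈ P | ⟪a, y - p⟫_ℝ = 1} with hF
    set D := (affineSpan ℝ F).direction with hD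
    have hDeq : D = Submodule.span ℝ (F -ᵥ F) := direction_affineSpan ℝ F
    have hperp : Dᗮ = Submodule.span ℝ {a} := by
      apply le_antisymm
      · intro w hw
        have hc : w - ⟪y₀ - p, w⟫_ℝ • a = 0 := by
          refine hspan _ fun y hy hy1 => ?_
          have h1 : ⟪y - y₀, w⟫_ℝ = 0 := (Submodule.mem_orthogonal _ _).1 hw _ <| by
            rw [hDeq]
            exact Submodule.subset_span ⟨y, ⟨hy, hy1⟩, y₀, ⟨hy₀, hy₀1⟩, rfl⟩
          rw [inner_sub_right, inner_smul_right, real_inner_comm a, hy1, mul_one,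
            ← inner_sub_left, sub_sub_sub_cancel_right, h1]
        exact Submodule.mem_span_singleton.2 ⟨_, (sub_eq_zero.1 hc).symm⟩
      · rw [Submodule.span_le, Set.singleton_subset_iff, SetLike.mem_coe, hDeq,
          Submodule.mem_orthogonal]
        intro u hu
        rw [real_inner_comm]
        refine Submodule.span_induction (p := fun u _ => ⟪a, u⟫_ℝ = 0) ?_ (by simp) ?_ ?_ hu
        · rintro _ ⟨y, hy, z, hz, rfl⟩
          have h1 := hy.2
          have h2 := hz.2
          rw [inner_sub_right] at h1 h2
          simp only [vsub_eq_sub, inner_sub_right]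
          linarith
        · intro u v _ _ hu hv
          rw [inner_add_right, hu, hv, add_zero]
        · intro c u _ hu
          rw [inner_smul_right, hu, mul_zero]
    have ha : a ≠ 0 := by
      rintro rfl
      simp at hy₀1
    rw [← Submodule.finrank_add_finrank_orthogonal D, hperp, finrank_span_singleton ha]

/-- A polytope with an interior point has a facet: the polar with respect to that point is compact,
so it has an extreme point, and the constraints active there come from points of a generating set
whose affine span is a hyperplane. -/
theorem IsConvexPolytope.polytopeFacets_nonempty [Nontrivial E] {P : Set E}
    (hP : IsConvexPolytope P) {p : E} (hp : p ∈ interior P) : (polytopeFacets P).Nonempty := by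
  obtain ⟨S, rfl⟩ := hP
  set a : S → E := fun s => s - p with ha
  have hle : ∀ x ∈ dualPolyhedron a, ∀ y ∈ convexHull ℝ (S : Set E), ⟪x, y - p⟫_ℝ ≤ 1 := by
    intro x hx y hy
    have hconv : Convex ℝ {y | innerₗ E x y ≤ 1 + ⟪x, p⟫_ℝ} :=
      convex_halfSpace_le (innerₗ E x).isLinear _
    have hsub : (S : Set E) ⊆ {y | innerₗ E x y ≤ 1 + ⟪x, p⟫_ℝ} := fun s hs => by
      have := hx ⟨s, hs⟩
      simp only [ha, real_inner_comm, inner_sub_right] at this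
      simp only [Set.mem_ofPred_eq, innerₗ_apply_apply]
      linarith [real_inner_comm x s, real_inner_comm x p]
    have := convexHull_min hsub hconv hy
    simp only [Set.mem_ofPred_eq, innerₗ_apply_apply] at this
    rw [inner_sub_right]
    linarith
  obtain ⟨r, hr, hball⟩ := Metric.isOpen_iff.1 isOpen_interior p hp
  have hcomp : IsCompact (dualPolyhedron a) := by
    refine Metric.isCompact_of_isClosed_isBounded (isClosed_dualPolyhedron a)
      (isBounded_iff_forall_norm_le.2 ⟨2 / r, fun x hx => ?_⟩)
    rcases eq_or_ne x 0 with rfl | hx0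
    · rw [norm_zero]; positivity
    have hx1 : 0 < ‖x‖ := norm_pos_iff.2 hx0
    have hmem : p + (r / 2 / ‖x‖) • x ∈ convexHull ℝ (S : Set E) := by
      refine interior_subset (hball ?_)
      rw [mem_ball_iff_norm, add_sub_cancel_left, norm_smul, Real.norm_of_nonneg (by positivity),
        div_mul_cancel₀ _ hx1.ne']
      linarith
    have h := hle x hx _ hmem
    rw [add_sub_cancel_left, inner_smul_right, real_inner_self_eq_norm_sq] at h
    rw [le_div_iff₀ hr]
    have : r / 2 / ‖x‖ * ‖x‖ ^ 2 = r / 2 * ‖x‖ := by field_simp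
    linarith
  obtain ⟨x, hx⟩ := hcomp.extremePoints_nonempty ⟨0, fun i => by simp⟩
  refine ⟨_, mem_polytopeFacets_of_span (a := x) hp (hle x hx.1) ?_ fun w hw => ?_⟩
  · by_contra! hno
    obtain ⟨v, hv⟩ := exists_ne (0 : E)
    refine hv (eq_zero_of_mem_extremePoints_dualPolyhedron hx fun i hi => ?_)
    exact absurd ((real_inner_comm _ _).trans hi) (hno i (subset_convexHull ℝ _ i.2))
  · refine eq_zero_of_mem_extremePoints_dualPolyhedron hx fun i hi => ?_
    exact hw i (subset_convexHull ℝ _ i.2) ((real_inner_comm _ _).trans hi)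

/-- The inequality `i` is irredundant if it is tight at a point where all others are strict. -/
theorem dualPolyhedron_facet_mem {ι : Type*} [Finite ι] {a : ι → E} {i : ι} {y : E}
    (hy : ⟪a i, y⟫_ℝ = 1) (hy' : ∀ j, j ≠ i → ⟪a j, y⟫_ℝ < 1) :
    {x ∈ dualPolyhedron a | ⟪a i, x⟫_ℝ = 1} ∈ polytopeFacets (dualPolyhedron a) := by
  have hmem : y ∈ dualPolyhedron a := fun j => by
    by_cases hj : j = i
    · exact hj ▸ hy.le
    · exact (hy' j hj).le
  have h0 : (0 : E) ∈ interior (dualPolyhedron a) := mem_interior_dualPolyhedron fun i => by simp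
  have := mem_polytopeFacets_of_span (a := a i) h0 (fun x hx => by simpa using hx i)
    ⟨y, hmem, by simpa using hy⟩ ?_
  · simpa using this
  intro w hw
  simp only [sub_zero] at hw
  have hyw : ⟪y, w⟫_ℝ = 0 := hw y hmem hy
  -- a small displacement of `y` parallel to the hyperplane stays in the polyhedron
  have hperp : ∀ v, ⟪a i, v⟫_ℝ = 0 → ⟪v, w⟫_ℝ = 0 := by
    intro v hv
    have h : ∀ᶠ ε : ℝ in nhds 0, ∀ j, j ≠ i → ⟪a j, y + ε • v⟫_ℝ < 1 := by
      refine Filter.eventually_all.2 fun j => ?_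
      by_cases hj : j = i
      · exact Filter.Eventually.of_forall fun ε h => absurd hj h
      · have : ∀ᶠ ε : ℝ in nhds 0, ⟪a j, y + ε • v⟫_ℝ < 1 :=
          ContinuousAt.eventually_lt (by fun_prop) continuousAt_const (by simpa using hy' j hj)
        filter_upwards [this] with ε hε _ using hε
    obtain ⟨δ, hδ, h⟩ := Metric.eventually_nhds_iff.1 h
    have h := h (y := δ / 2) (by simp [abs_of_pos hδ, hδ])
    have hi : ⟪a i, y + (δ / 2) • v⟫_ℝ = 1 := by
      rw [inner_add_right, inner_smul_right, hv, hy, mul_zero, add_zero]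
    have := hw (y + (δ / 2) • v) (fun j => by
      by_cases hj : j = i
      · exact hj ▸ hi.le
      · exact (h j hj).le) hi
    rw [inner_add_left, hyw, inner_smul_left, zero_add] at this
    exact (mul_eq_zero.1 this).resolve_left (by simpa using hδ.ne')
  -- `w` is orthogonal to `y` and to the hyperplane, hence to everything
  refine inner_self_eq_zero (𝕜 := ℝ) |>.1 ?_
  have h1 := hperp (w - ⟪a i, w⟫_ℝ • y) (by
    rw [inner_sub_right, inner_smul_right, hy, mul_one, sub_self])
  rwa [inner_sub_left, inner_smul_left, hyw, mul_zero, sub_zero] at h1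

theorem polytopeFacets_dualPolyhedron {ι : Type*} [Fintype ι] [Nonempty ι] {a : ι → E}
    (h : ∀ i, ∃ y, ⟪a i, y⟫_ℝ = 1 ∧ ∀ j, j ≠ i → ⟪a j, y⟫_ℝ < 1) :
    Set.range (fun i => {x ∈ dualPolyhedron a | ⟪a i, x⟫_ℝ = 1}) =
      polytopeFacets (dualPolyhedron a) := by
  have h0 : (0 : E) ∈ interior (dualPolyhedron a) := mem_interior_dualPolyhedron fun i => by simp
  apply Set.Subset.antisymm
  · rintro _ ⟨i, rfl⟩
    obtain ⟨y, hy, hy'⟩ := h i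
    exact dualPolyhedron_facet_mem hy hy'
  intro F hF
  have hsub : F ⊆ dualPolyhedron a := hF.2.1.subset
  obtain ⟨i, hi⟩ : ∃ i, ∀ x ∈ F, ⟪a i, x⟫_ℝ = 1 := by
    by_contra! hno
    -- otherwise the barycentre of points of `F` off the hyperplanes is interior
    choose x hxF hx using hno
    set c : ℝ := (Fintype.card ι : ℝ)⁻¹ with hc
    have hc0 : 0 < c := inv_pos.2 (Nat.cast_pos.2 Fintype.card_pos)
    have hc1 : ∑ _i : ι, c = 1 := by
      rw [Finset.sum_const, Finset.card_univ, nsmul_eq_mul, hc]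
      exact mul_inv_cancel₀ (Nat.cast_ne_zero.2 Fintype.card_ne_zero)
    have hmem : ∑ i, c • x i ∈ F := (hF.2.1.convex (convex_dualPolyhedron a)).sum_mem
      (fun _ _ => hc0.le) hc1 fun i _ => hxF i
    have hint : ∑ i, c • x i ∈ interior (dualPolyhedron a) := by
      refine mem_interior_dualPolyhedron fun i => ?_
      rw [inner_sum, ← hc1]
      simp only [inner_smul_right]
      refine Finset.sum_lt_sum (fun j _ => ?_) ⟨i, Finset.mem_univ _, ?_⟩
      · exact mul_le_of_le_one_right hc0.le (hsub (hxF j) i)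
      · exact mul_lt_of_lt_one_right hc0 (lt_of_le_of_ne (hsub (hxF i) i) (hx i))
    obtain ⟨φ, hφ⟩ := exists_functional_of_mem_polytopeFacets hint hF
    simpa using (hφ _).1 (subset_affineSpan ℝ _ hmem)
  refine ⟨i, ?_⟩
  have hdim := hF.2.2
  rw [finrank_direction_of_mem_interior h0] at hdim
  have hspan := mem_affineSubspace_iff_of_finrank (A := affineSpan ℝ F) (φ := innerₗ E (a i))
    (p := 0) (hF.1.mono (subset_affineSpan ℝ _)) ?_ hdim
  · ext x
    rw [mem_iff_mem_affineSpan_of_mem_polytopeFacets hF, hspan]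
    simp
  · intro x hx
    rw [sub_zero]
    exact apply_eq_of_mem_affineSpan (φ := innerₗ E (a i)) hi hx

theorem affineSpan_facet_dualPolyhedron {ι : Type*} [Finite ι] {a : ι → E} {i : ι}
    (hF : {x ∈ dualPolyhedron a | ⟪a i, x⟫_ℝ = 1} ∈ polytopeFacets (dualPolyhedron a)) (x : E) :
    x ∈ affineSpan ℝ {x ∈ dualPolyhedron a | ⟪a i, x⟫_ℝ = 1} ↔ innerₗ E (a i) (x - 0) = 1 := by
  have h0 : (0 : E) ∈ interior (dualPolyhedron a) := mem_interior_dualPolyhedron fun i => by simp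
  have hdim := hF.2.2
  rw [finrank_direction_of_mem_interior h0] at hdim
  refine mem_affineSubspace_iff_of_finrank (hF.1.mono (subset_affineSpan ℝ _)) ?_ hdim x
  intro x hx
  rw [sub_zero]
  exact apply_eq_of_mem_affineSpan (φ := innerₗ E (a i)) (fun z hz => hz.2) hx

end DualPolyhedron

/-! ### Points in general position -/

section GeneralPosition

theorem SweepGeneric.map {W W' : Type*} [AddCommGroup W] [Module ℝ W] [AddCommGroup W']
    [Module ℝ W'] {d n : ℕ} {f : Fin n → W} (hf : SweepGeneric d f) {L : W →ₗ[ℝ] W'}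
    (hL : Function.Injective L) : SweepGeneric d (fun i => L (f i)) := by
  intro k i hki T hT hkT hmem
  refine hf k i hki T hT hkT ?_
  have himg : (fun p : Fin n × Fin n => L (f p.1) - L (f p.2)) '' T =
      L '' ((fun p : Fin n × Fin n => f p.1 - f p.2) '' T) := by
    rw [Set.image_image]
    exact Set.image_congr fun p _ => (map_sub L _ _).symm
  rw [himg, Submodule.span_image, ← map_sub] at hmem
  obtain ⟨t, ht, htL⟩ := hmem
  rwa [← hL htL]

theorem SweepGeneric.cons {W : Type*} [AddCommGroup W] [Module ℝ W] {d n : ℕ} {f : Fin n → W}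
    (hf : SweepGeneric d f) {x : W}
    (hx : ∀ (i : Fin n) (T : Finset (Fin n × Fin n)), T.card < d →
      x - f i ∉ Submodule.span ℝ ((fun p : Fin n × Fin n => f p.1 - f p.2) '' T)) :
    SweepGeneric d (Fin.cons x f : Fin (n + 1) → W) := by
  classical
  intro k i hki T hT hkT
  -- the pairs in `T` avoid the index `0`, so they come from pairs of indices of `f`
  set T' : Finset (Fin n × Fin n) := Finset.univ.filter fun q => (q.1.succ, q.2.succ) ∈ T with hT'
  have hcard : T'.card ≤ T.card :=
    Finset.card_le_card_of_injOn (fun q => (q.1.succ, q.2.succ))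
      (fun q hq => (Finset.mem_filter.1 hq).2) fun q _ q' _ h => by
        simpa [Prod.ext_iff] using h
  have himg : (fun p : Fin (n + 1) × Fin (n + 1) =>
      (Fin.cons x f : Fin (n + 1) → W) p.1 - (Fin.cons x f : Fin (n + 1) → W) p.2) '' T =
      (fun p : Fin n × Fin n => f p.1 - f p.2) '' T' := by
    ext w
    constructor
    · rintro ⟨⟨p, q⟩, hp, rfl⟩
      obtain ⟨h1, h2⟩ := hkT _ hp
      obtain ⟨p, rfl⟩ := Fin.exists_succ_eq.2 (Fin.ne_zero_of_lt h1)
      obtain ⟨q, rfl⟩ := Fin.exists_succ_eq.2 (Fin.ne_zero_of_lt h2)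
      exact ⟨(p, q), by simpa [hT'] using hp, by simp⟩
    · rintro ⟨⟨p, q⟩, hp, rfl⟩
      exact ⟨(p.succ, q.succ), by simpa [hT'] using hp, by simp⟩
  rw [himg]
  obtain ⟨i, rfl⟩ := Fin.exists_succ_eq.2 (Fin.ne_zero_of_lt hki)
  rcases Fin.eq_zero_or_eq_succ k with rfl | ⟨k, rfl⟩
  · simpa using hx i T' (hcard.trans_lt hT)
  · have := hf k i (Fin.succ_lt_succ_iff.1 hki) T' (hcard.trans_lt hT) fun q hq => by
      obtain ⟨h1, h2⟩ := hkT _ (Finset.mem_filter.1 hq).2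
      exact ⟨Fin.succ_lt_succ_iff.1 h1, Fin.succ_lt_succ_iff.1 h2⟩
    simpa using this

variable {E : Type*} [NormedAddCommGroup E] [NormedSpace ℝ E] [FiniteDimensional ℝ E]

theorem exists_mem_forall_sub_notMem {ι : Type*} [Countable ι] (c : ι → E)
    {p : ι → Submodule ℝ E} (hp : ∀ j, p j ≠ ⊤) {U : Set E} (hU : IsOpen U) (hne : U.Nonempty) :
    ∃ x ∈ U, ∀ j, x - c j ∉ p j := by
  have : CompleteSpace E := FiniteDimensional.complete ℝ E
  have hdense : Dense (⋂ j, {x | x - c j ∉ p j}) := by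
    refine dense_iInter_of_isOpen (fun j => ?_) fun j => ?_
    · exact ((p j).closed_of_finiteDimensional.preimage
        (continuous_id.sub continuous_const)).isOpen_compl
    · have hint : interior (p j : Set E) = ∅ := by
        by_contra h
        exact hp j ((p j).eq_top_of_nonempty_interior' (Set.nonempty_iff_ne_empty.2 h))
      exact (interior_eq_empty_iff_dense_compl.1 hint).preimage
        (Homeomorph.subRight (c j)).isOpenMap
  obtain ⟨x, hxU, hx⟩ := hdense.inter_open_nonempty U hU hne
  exact ⟨x, hxU, fun j => Set.mem_iInter.1 hx j⟩

/-- Points in general position can be chosen in prescribed open sets, since each new point has to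
avoid only finitely many proper affine subspaces. -/
theorem exists_sweepGeneric {n : ℕ} (U : Fin n → Set E) (hU : ∀ i, IsOpen (U i))
    (hne : ∀ i, (U i).Nonempty) :
    ∃ a : Fin n → E, (∀ i, a i ∈ U i) ∧ SweepGeneric (Module.finrank ℝ E) a := by
  classical
  induction n with
  | zero => exact ⟨fun i => i.elim0, fun i => i.elim0, fun i => i.elim0⟩
  | succ n ih =>
    obtain ⟨a, haU, ha⟩ := ih (fun i => U i.succ) (fun i => hU _) fun i => hne _
    -- fewer vectors than the dimension do not span
    have hspan : ∀ j : Fin n × {T : Finset (Fin n × Fin n) // T.card < Module.finrank ℝ E},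
        Submodule.span ℝ ((fun p : Fin n × Fin n => a p.1 - a p.2) ''
          (j.2.1 : Set (Fin n × Fin n))) ≠ ⊤ := fun j h => by
      have h1 := finrank_span_finset_le_card (R := ℝ)
        (j.2.1.image fun p : Fin n × Fin n => a p.1 - a p.2)
      rw [Finset.coe_image, Set.finrank, h, finrank_top] at h1
      exact absurd (h1.trans Finset.card_image_le) (not_le.2 j.2.2)
    obtain ⟨x, hxU, hx⟩ := exists_mem_forall_sub_notMem (fun j => a j.1) hspan (hU 0) (hne 0)
    refine ⟨Fin.cons x a, fun i => ?_, ha.cons fun i T hT => hx (i, ⟨T, hT⟩)⟩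
    refine Fin.cases ?_ (fun i => ?_) i
    · simpa using hxU
    · simpa using haU i

end GeneralPosition

/-! ### Polytopes from points surrounding the origin -/

section Configuration

open scoped InnerProductSpace

/-- Points whose polar is a polytope with one facet for each of them: they surround the origin, and
each is the unique maximizer among them of some linear functional. The constant `c` in the first
condition makes the polar bounded. -/
structure IsPolarConfiguration {E : Type*} [NormedAddCommGroup E] [InnerProductSpace ℝ E] {m : ℕ}
    (a : Fin m → E) : Prop where
  surrounds : ∃ c : ℝ, 0 < c ∧ ∀ x, ∃ i, c * ‖x‖ ≤ ⟪a i, x⟫_ℝ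
  exposed : ∀ i, ∃ y, ⟪a i, y⟫_ℝ = 1 ∧ ∀ j, j ≠ i → ⟪a j, y⟫_ℝ < 1

variable {E : Type*} [NormedAddCommGroup E] [InnerProductSpace ℝ E] {m : ℕ}

theorem IsPolarConfiguration.isCompact [FiniteDimensional ℝ E] {a : Fin m → E}
    (ha : IsPolarConfiguration a) : IsCompact (dualPolyhedron a) := by
  obtain ⟨c, hc, h⟩ := ha.surrounds
  refine Metric.isCompact_of_isClosed_isBounded (isClosed_dualPolyhedron a)
      (isBounded_iff_forall_norm_le.2 ⟨1 / c, fun x hx => ?_⟩)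
  obtain ⟨i, hi⟩ := h x
  rw [le_div_iff₀ hc, mul_comm]
  exact hi.trans (hx i)

/-- Both conditions of a polar configuration are stable under small displacements of distinct unit
vectors that surround the origin. -/
theorem exists_isPolarConfiguration_sweepGeneric [FiniteDimensional ℝ E] [Nontrivial E]
    {v : Fin m → E} (hv : Function.Injective v) (hv1 : ∀ i, ‖v i‖ = 1)
    (hpos : ∀ x, x ≠ 0 → ∃ i, 0 < ⟪v i, x⟫_ℝ) :
    ∃ a : Fin m → E, IsPolarConfiguration a ∧ SweepGeneric (Module.finrank ℝ E) a := by
  classical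
  have hne : (Finset.univ : Finset (Fin m)).Nonempty := by
    obtain ⟨x, hx⟩ := exists_ne (0 : E)
    obtain ⟨i, -⟩ := hpos x hx
    exact ⟨i, Finset.mem_univ _⟩
  obtain ⟨c, hc, hcx⟩ : ∃ c : ℝ, 0 < c ∧ ∀ x : E, ‖x‖ = 1 → ∃ i, c ≤ ⟪v i, x⟫_ℝ := by
    have hcont : Continuous fun x : E => Finset.univ.sup' hne fun i => ⟪v i, x⟫_ℝ :=
      Continuous.finset_sup'_apply hne fun i _ => by fun_prop
    obtain ⟨x₀, hx₀, hmin⟩ := (isCompact_sphere (0 : E) 1).exists_isMinOn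
      (NormedSpace.sphere_nonempty.2 zero_le_one) hcont.continuousOn
    have hx₀' : x₀ ≠ 0 := by
      rintro rfl
      simp at hx₀
    obtain ⟨i, hi⟩ := hpos x₀ hx₀'
    refine ⟨_, hi.trans_le (Finset.le_sup' (fun i => ⟪v i, x₀⟫_ℝ) (Finset.mem_univ i)),
      fun x hx => ?_⟩
    obtain ⟨j, -, hj⟩ := Finset.exists_mem_eq_sup' hne fun i => ⟪v i, x⟫_ℝ
    exact ⟨j, hj ▸ hmin (by simpa using hx)⟩
  have hvv : ∀ i j, j ≠ i → ⟪v j, v i⟫_ℝ < 1 := fun i j hij =>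
    inner_lt_one_iff_real_of_norm_eq_one (hv1 j) (hv1 i) |>.2 fun h => hij (hv h)
  obtain ⟨ε, ⟨hεv, hεc, hε1⟩, hε⟩ : ∃ ε : ℝ, ((∀ i j, j ≠ i → ⟪v j, v i⟫_ℝ + ε < 1 - ε) ∧
      ε < c ∧ ε < 1) ∧ 0 < ε := by
    have h1 : ∀ᶠ ε : ℝ in nhds 0, ∀ i j, j ≠ i → ⟪v j, v i⟫_ℝ + ε < 1 - ε := by
      refine Filter.eventually_all.2 fun i => Filter.eventually_all.2 fun j => ?_
      by_cases hij : j = i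
      · exact Filter.Eventually.of_forall fun ε h => absurd hij h
      · have : ∀ᶠ ε : ℝ in nhds 0, ⟪v j, v i⟫_ℝ + ε < 1 - ε :=
          ContinuousAt.eventually_lt (by fun_prop) (by fun_prop) (by simpa using hvv i j hij)
        filter_upwards [this] with ε hε _ using hε
    have h2 := h1.and ((eventually_lt_nhds hc).and (eventually_lt_nhds (zero_lt_one (α := ℝ))))
    exact ((h2.filter_mono nhdsWithin_le_nhds).and
      (self_mem_nhdsWithin : Set.Ioi (0 : ℝ) ∈ nhdsWithin 0 (Set.Ioi 0))).exists
  obtain ⟨a, haU, ha⟩ := exists_sweepGeneric (fun i => Metric.ball (v i) ε)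
    (fun i => Metric.isOpen_ball) fun i => Metric.nonempty_ball.2 hε
  have hdist : ∀ i x, |⟪a i, x⟫_ℝ - ⟪v i, x⟫_ℝ| ≤ ε * ‖x‖ := fun i x => by
    rw [← inner_sub_left]
    refine (abs_real_inner_le_norm _ _).trans (mul_le_mul_of_nonneg_right ?_ (norm_nonneg x))
    exact (mem_ball_iff_norm.1 (haU i)).le
  refine ⟨a, ⟨⟨c - ε, sub_pos.2 hεc, fun x => ?_⟩, fun i => ?_⟩, ha⟩
  · rcases eq_or_ne x 0 with rfl | hx
    · exact ⟨hne.choose, by simp⟩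
    have hx0 : 0 < ‖x‖ := norm_pos_iff.2 hx
    obtain ⟨i, hi⟩ := hcx (‖x‖⁻¹ • x) (by
      rw [norm_smul, norm_inv, norm_norm, inv_mul_cancel₀ hx0.ne'])
    rw [inner_smul_right, ← div_eq_inv_mul, le_div_iff₀ hx0] at hi
    exact ⟨i, by linarith [(abs_le.1 (hdist i x)).1]⟩
  · have hi := (abs_le.1 (hdist i (v i))).1
    rw [real_inner_self_eq_norm_sq, hv1] at hi
    have hpos : 0 < ⟪a i, v i⟫_ℝ := by linarith
    refine ⟨(⟪a i, v i⟫_ℝ)⁻¹ • v i, ?_, fun j hj => ?_⟩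
    · rw [inner_smul_right, inv_mul_cancel₀ hpos.ne']
    · rw [inner_smul_right, inv_mul_lt_iff₀ hpos, mul_one]
      have hj' := (abs_le.1 (hdist j (v i))).2
      rw [hv1] at hj'
      linarith [hεv i j hj]

/-- A polar configuration in general position gives a polytope with one facet for each point and
with as many line shellings through the origin as there are orderings. -/
theorem IsPolarConfiguration.encard_lineShellings [FiniteDimensional ℝ E] (hm : 0 < m)
    {a : Fin m → E} (ha : IsPolarConfiguration a) (hgen : SweepGeneric (Module.finrank ℝ E) a) :
    (polytopeFacets (dualPolyhedron a)).encard = m ∧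
      (lineShellings (dualPolyhedron a) 0 m).encard =
        genericSweepCount (Module.finrank ℝ E) m := by
  have : Nonempty (Fin m) := ⟨⟨0, hm⟩⟩
  set e : Fin m → Set E := fun i => {x ∈ dualPolyhedron a | ⟪a i, x⟫_ℝ = 1} with he
  have hrange : Set.range e = polytopeFacets (dualPolyhedron a) :=
    polytopeFacets_dualPolyhedron ha.exposed
  have hinj : Function.Injective e := by
    intro i j hij
    by_contra hne
    obtain ⟨y, hy, hy'⟩ := ha.exposed i
    have hmem : y ∈ e i := ⟨fun k => by
      by_cases hk : k = i
      · exact hk ▸ hy.le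
      · exact (hy' k hk).le, hy⟩
    rw [hij] at hmem
    exact (hy' j (Ne.symm hne)).ne hmem.2
  constructor
  · rw [← hrange, ← Set.image_univ, hinj.encard_image, Set.encard_univ]
    simp
  · rw [_root_.encard_lineShellings hinj hrange hm (a := fun i => innerₗ E (a i)) fun i x =>
      affineSpan_facet_dualPolyhedron (hrange ▸ Set.mem_range_self i) x,
      ← (Set.toFinite _).cast_ncard_eq, SweepGeneric.ncard_sweepOrders]
    refine hgen.map (L := innerₗ E) ?_
    rw [← LinearMap.ker_eq_bot, LinearMap.ker_eq_bot']
    intro x hx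
    exact inner_self_eq_zero (𝕜 := ℝ) |>.1 (LinearMap.congr_fun hx x)

end Configuration

/-! ### Unit vectors surrounding the origin -/

section UnitVectors

open scoped InnerProductSpace

/-- The standard basis vectors together with the normalization of minus their sum. -/
theorem exists_finset_sphere_surrounding (d : ℕ) :
    ∃ A : Finset (EuclideanSpace ℝ (Fin (d + 1))), A.card ≤ d + 2 ∧ (∀ v ∈ A, ‖v‖ = 1) ∧
      ∀ x, x ≠ 0 → ∃ v ∈ A, 0 < ⟪v, x⟫_ℝ := by
  classical
  set b : Fin (d + 1) → EuclideanSpace ℝ (Fin (d + 1)) := fun i => EuclideanSpace.single i 1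
    with hb
  have hbx : ∀ i x, ⟪b i, x⟫_ℝ = x i := fun i x => by simp [hb, EuclideanSpace.inner_single_left]
  set s := ∑ i, b i with hs
  have hsx : ∀ x, ⟪s, x⟫_ℝ = ∑ i, x i := fun x => by simp only [hs, sum_inner, hbx]
  have hs0 : s ≠ 0 := fun h => by
    have := hsx (b 0)
    rw [h, inner_zero_left] at this
    simp [hb] at this
  have hs1 : 0 < ‖s‖ := norm_pos_iff.2 hs0
  refine ⟨insert (-(‖s‖⁻¹ • s)) (Finset.univ.image b), ?_, ?_, ?_⟩
  · refine (Finset.card_insert_le _ _).trans (Nat.succ_le_succ (Finset.card_image_le.trans ?_))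
    simp
  · intro v hv
    rcases Finset.mem_insert.1 hv with rfl | hv
    · rw [norm_neg, norm_smul, norm_inv, norm_norm, inv_mul_cancel₀ hs1.ne']
    · obtain ⟨i, -, rfl⟩ := Finset.mem_image.1 hv
      simp [hb]
  · intro x hx
    by_contra! h
    have hle : ∀ i, x i ≤ 0 := fun i => by
      rw [← hbx]
      exact h _ (Finset.mem_insert_of_mem (Finset.mem_image_of_mem b (Finset.mem_univ i)))
    have hsum : 0 ≤ ∑ i, x i := by
      have := h _ (Finset.mem_insert_self _ _)
      rw [inner_neg_left, inner_smul_left, hsx, neg_nonpos] at this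
      exact nonneg_of_mul_nonneg_right this (inv_pos.2 hs1)
    refine hx (PiLp.ext fun i => ?_)
    exact (Finset.sum_eq_zero_iff_of_nonpos fun i _ => hle i).1
      (le_antisymm (Finset.sum_nonpos fun i _ => hle i) hsum) i (Finset.mem_univ i)

theorem le_encard_sphere {d m : ℕ} (h : d = 0 → m = 2) :
    (m : ℕ∞) ≤ (Metric.sphere (0 : EuclideanSpace ℝ (Fin (d + 1))) 1).encard := by
  set E := EuclideanSpace ℝ (Fin (d + 1))
  obtain ⟨x, hx⟩ : (Metric.sphere (0 : E) 1).Nonempty := NormedSpace.sphere_nonempty.2 zero_le_one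
  have hx1 : ‖x‖ = 1 := by simpa using hx
  have hne : x ≠ -x := fun h => by
    have h2 : (2 : ℝ) • x = 0 := by rw [two_smul]; exact add_eq_zero_iff_eq_neg.2 h
    rw [(smul_eq_zero.1 h2).resolve_left two_ne_zero, norm_zero] at hx1
    exact zero_ne_one hx1
  have hmem : -x ∈ Metric.sphere (0 : E) 1 := by simpa using hx1
  rcases Nat.eq_zero_or_pos d with hd | hd
  · rw [h hd]
    calc ((2 : ℕ) : ℕ∞) = ({x, -x} : Set E).encard := by rw [Set.encard_pair hne]; rfl
      _ ≤ _ := Set.encard_le_encard (Set.pair_subset hx hmem)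
  · have hrank : 1 < Module.rank ℝ E := by
      rw [← Module.finrank_eq_rank, finrank_euclideanSpace_fin]
      exact_mod_cast Nat.succ_lt_succ hd
    have := (isPreconnected_sphere hrank (0 : E) 1).infinite_of_nontrivial ⟨x, hx, -x, hmem, hne⟩
    rw [this.encard_eq]
    exact le_top

theorem exists_injective_unit_surrounding {d m : ℕ} (hm : d + 2 ≤ m) (h : d = 0 → m = 2) :
    ∃ v : Fin m → EuclideanSpace ℝ (Fin (d + 1)), Function.Injective v ∧ (∀ i, ‖v i‖ = 1) ∧
      ∀ x, x ≠ 0 → ∃ i, 0 < ⟪v i, x⟫_ℝ := by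
  obtain ⟨A, hcard, hA1, hA⟩ := exists_finset_sphere_surrounding d
  obtain ⟨B, hAB, hB, hBcard⟩ := Set.exists_superset_subset_encard_eq (k := (m : ℕ∞))
    (show (A : Set (EuclideanSpace ℝ (Fin (d + 1)))) ⊆ Metric.sphere 0 1 from
      fun v hv => by simpa using hA1 v hv)
    (by rw [Set.encard_coe_eq_coe_finsetCard]; exact_mod_cast hcard.trans hm)
    (le_encard_sphere h)
  obtain ⟨n, v, hv, hrange⟩ := (Set.finite_of_encard_eq_coe hBcard).fin_param
  obtain rfl : n = m := by
    rw [← hrange, ← Set.image_univ, hv.encard_image, Set.encard_univ] at hBcard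
    simpa using hBcard
  refine ⟨v, hv, fun i => by simpa using hB (hrange ▸ Set.mem_range_self i), fun x hx => ?_⟩
  obtain ⟨w, hw, hwx⟩ := hA x hx
  obtain ⟨i, rfl⟩ := (hrange ▸ hAB hw : w ∈ Set.range v)
  exact ⟨i, hwx⟩

end UnitVectors

/-! ### The bound and its attainment -/

theorem lineShellings_encard_le {d : ℕ} (hd : 1 ≤ d) {m : ℕ}
    {P : Set (EuclideanSpace ℝ (Fin d))} (hP : IsConvexPolytope P)
    (hcard : (polytopeFacets P).encard = m) {p : EuclideanSpace ℝ (Fin d)} (hp : p ∈ interior P) :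
    (lineShellings P p m).encard ≤ lineShellingBound d m := by
  have : Nonempty (Fin d) := ⟨⟨0, hd⟩⟩
  have hm : 0 < m := by
    have h := Set.encard_pos.2 (hP.polytopeFacets_nonempty hp)
    rw [hcard] at h
    exact_mod_cast h
  obtain ⟨n, e, he, hrange⟩ := (Set.finite_of_encard_eq_coe hcard).fin_param
  obtain rfl : n = m := by
    rw [← hrange, ← Set.image_univ, he.encard_image, Set.encard_univ] at hcard
    simpa using hcard
  choose a ha using fun i => exists_functional_of_mem_polytopeFacets hp
    (hrange ▸ Set.mem_range_self i : e i ∈ polytopeFacets P)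
  rw [encard_lineShellings he hrange hm ha, ← (Set.toFinite _).cast_ncard_eq, Nat.cast_le]
  have h := ncard_sweepOrders_le a
  rw [finrank_euclideanSpace_fin] at h
  refine h.trans ?_
  -- the recursion agrees with the bound from two facets on; for one facet an estimate suffices
  rcases Nat.lt_or_ge n 2 with hn | hn
  · obtain rfl : n = 1 := by omega
    rw [genericSweepCount_one_right, lineShellingBound_of_le hd, lineShellingBound_one le_rfl]
    norm_num
  · exact (genericSweepCount_eq_lineShellingBound hd hn).le

theorem mainTheorem3 (d : ℕ) (hd : 1 ≤ d) (m : ℕ) :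
    (∀ P : Set (EuclideanSpace ℝ (Fin d)), IsConvexPolytope P →
      (polytopeFacets P).encard = m →
      ∀ p ∈ interior P, (lineShellings P p m).encard ≤ lineShellingBound d m) ∧
    (d + 1 ≤ m → (d = 1 → m = 2) →
      ∃ P : Set (EuclideanSpace ℝ (Fin d)), IsConvexPolytope P ∧
        (polytopeFacets P).encard = m ∧
        ∃ p ∈ interior P, (lineShellings P p m).encard = lineShellingBound d m) := by
  refine ⟨fun P hP hcard p hp => lineShellings_encard_le hd hP hcard hp, fun hdm h1 => ?_⟩
  obtain ⟨d, rfl⟩ := Nat.exists_eq_add_of_le' hd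
  obtain ⟨v, hv, hv1, hpos⟩ := exists_injective_unit_surrounding (d := d) hdm
    fun h => h1 (by omega)
  obtain ⟨a, ha, hgen⟩ := exists_isPolarConfiguration_sweepGeneric hv hv1 hpos
  obtain ⟨hcard, hshell⟩ := ha.encard_lineShellings (by omega) hgen
  rw [finrank_euclideanSpace_fin, genericSweepCount_eq_lineShellingBound hd (by omega)] at hshell
  exact ⟨_, isConvexPolytope_dualPolyhedron ha.isCompact, hcard, 0,
    mem_interior_dualPolyhedron fun i => by simp, hshell⟩
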